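/- **Setup.** Let $K\ge 1$ and, for each action $a\in[K]=\{1,\dots,K\}$, let $f_{a,0}$ (pre-change) and $f_{a,1}$ (post-change) be probability densities with respect to a common measure $\lambda$. Write $\mathrm{LLR}(a,x)=\log\big(f_{a,1}(x)/f_{a,0}(x)\big)\in[-\infty,\infty]$ and $D_a=D(f_{a,1}\|f_{a,0})=\int \log(f_{a,1}/f_{a,0})\,f_{a,1}\,d\lambda$. Assume that $0<D_a<\infty$ for every $a$, and that there is a constant $v<\infty$ with $\log\int \exp\!\big(\theta(\mathrm{LLR}(a,x)-D_a)\big)f_{a,1}(x)\,d\lambda(x)\le \tfrac{v}{2}\theta^2$ for all $a\in[K]$ and $\theta\in\mathbb R$. For $\nu\in\{1,2,\dots\}\cup\{\infty\}$ and nonempty $\mathcal A\subseteq[K]$, under $\mathbb P_{\nu,\mathcal A}$ the observations $X_{a,n}$ ($a\in[K]$, $n\ge1$) are independent, with $X_{a,n}\sim f_{a,1}$ if $n\ge\nu$ and $a\in\mathcal A$, and $X_{a,n}\sim f_{a,0}$ otherwise; $\mathbb P_\infty$ is the law without a change. When the actions $A_1,A_2,\dots$ are taken, $\mathcal F_n=\sigma(X_{A_1,1},\dots,X_{A_n,n})$.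 **Control policy.** For an integer $W\ge1$, $A_{\mathrm{UCB}}=(A_n)_{n\ge1}$ is a UCB policy restarted every $W$ steps: $A_n$ is $\mathcal F_{n-1}$-measurable and $$A_n\in\operatorname*{argmax}_{a\in[K]}\Big(\hat\mu_a+\sqrt{4v\log W/N_a}\Big),$$ where $N_a$ is the number of times $m\le i<n$ with $A_i=a$, $m=(\lceil n/W\rceil-1)W+1$ being the start of the current interval, $\hat\mu_a$ is the average of $\mathrm{LLR}(a,X_{a,i})$ over these times, and the index is $+\infty$ if $N_a=0$. Ties are broken arbitrarily. **Detector.** One CuSum statistic is kept per action: $C_{a,0}=0$; $C_{a,n}=\max\{C_{a,n-1},0\}+\mathrm{LLR}(a,X_{a,n})$ if $A_n=a$, and $C_{a,n}=C_{a,n-1}$ otherwise. The alarm time is $\tilde T_b=\inf\{n\ge1: C_{a,n}\ge b\text{ for some }a\in[K]\}$. The worst-case delay is $$\mathcal J_{\mathcal A}=\sup_{\nu\ge1}\operatorname{ess\,sup}\,\mathbb E_{\nu,\mathcal A}\big[(\tilde T_b-\nu+1)^+\,\big|\,\mathcal F_{\nu-1}\big],$$ and $I_{\mathcal A}=\max_{a\in\mathcal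 A}D_a$. **Theorem 2 (asymptotic optimality of PA-UCB-CuSum).** Let $b=\log\gamma$ with $\gamma>0$. (i) For every $W\ge1$ and $\gamma>0$, $\mathbb E_\infty[\tilde T_b]\ge\gamma$. (ii) Let $\mathcal A\subseteq[K]$ be nonempty, and suppose that the maximum $I_{\mathcal A}=\max_{a\in\mathcal A}D_a$ is attained at a single action $a^*\in\mathcal A$. Then, as $\gamma,W\to\infty$ with $W=o(\log\gamma)$, $$\mathcal J_{\mathcal A}\big(A_{\mathrm{UCB}},\tilde T_b\big)\le\frac{\log\gamma}{I_{\mathcal A}}\,(1+o(1)).$$ -/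

import Mathlib

open MeasureTheory ProbabilityTheory Filter Topology
open scoped ENNReal NNReal

/-- The data of a multichannel bandit quickest change detection problem with `K` channels and
observations in `𝓧`: for each action `a`, a pre-change density `f₀ a` and a post-change density
`f₁ a` with respect to a common dominating measure `lam`. -/
structure BanditQCD (K : ℕ) (𝓧 : Type*) [MeasurableSpace 𝓧] where
  /-- the dominating measure -/
  lam : Measure 𝓧
  /-- the pre-change densities -/
  f₀ : Fin K → 𝓧 → ℝ≥0∞
  /-- the post-change densities -/
  f₁ : Fin K → 𝓧 → ℝ≥0∞
  measurable_f₀ : ∀ a, Measurable (f₀ a)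
  measurable_f₁ : ∀ a, Measurable (f₁ a)
  lintegral_f₀ : ∀ a, ∫⁻ x, f₀ a x ∂lam = 1
  lintegral_f₁ : ∀ a, ∫⁻ x, f₁ a x ∂lam = 1

namespace BanditQCD

noncomputable section

variable {K : ℕ} {𝓧 : Type*} [MeasurableSpace 𝓧] (M : BanditQCD K 𝓧)

/-- The pre-change law of a single observation of channel `a`. -/
def pre (a : Fin K) : Measure 𝓧 := M.lam.withDensity (M.f₀ a)

/-- The post-change law of a single observation of channel `a`. -/
def post (a : Fin K) : Measure 𝓧 := M.lam.withDensity (M.f₁ a)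

instance isProbabilityMeasure_pre (a : Fin K) : IsProbabilityMeasure (M.pre a) :=
  ⟨by rw [pre, withDensity_apply _ MeasurableSet.univ]; simpa using M.lintegral_f₀ a⟩

instance isProbabilityMeasure_post (a : Fin K) : IsProbabilityMeasure (M.post a) :=
  ⟨by rw [post, withDensity_apply _ MeasurableSet.univ]; simpa using M.lintegral_f₁ a⟩

/-- The log-likelihood ratio `log (f₁ a x / f₀ a x)`, with values in `[-∞, ∞]`
(it is `-∞` where `f₁ a x = 0 < f₀ a x`). -/
def LLR (a : Fin K) (x : 𝓧) : EReal := ENNReal.log (M.f₁ a x / M.f₀ a x)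

/-- The Kullback-Leibler divergence `∫ log (f₁ a / f₀ a) * f₁ a ∂lam`. It is used for models
satisfying `Regular` only, where the log-likelihood ratio is finite almost everywhere under the
post-change law and integrable. -/
def KL (a : Fin K) : ℝ := ∫ x, (M.LLR a x).toReal ∂(M.post a)

/-- The standing assumption on the densities: the divergences are finite and positive, and the
log-likelihood ratios are `v`-sub-Gaussian under the post-change laws. The first field is part of
the finiteness of the divergence; the rest of it (integrability) follows from the third field. -/
structure Regular (v : ℝ≥0) : Prop where
  ac : ∀ a, M.post a ≪ M.pre a
  KL_pos : ∀ a, 0 < M.KL a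
  subGaussian : ∀ a, HasSubgaussianMGF (fun x => (M.LLR a x).toReal - M.KL a) v (M.post a)

/-- The sample space: `ω n a` is the observation `X_{a,n}` of channel `a` at time `n`. Time steps
are `n = 1, 2, …`; the coordinate `ω 0` is never used. -/
abbrev Path (K : ℕ) (𝓧 : Type*) : Type _ := ℕ → Fin K → 𝓧

/-- The law of `X_{a,n}` when the actions in `𝒜` change at time `ν` (`ν = ⊤`: no change). -/
def obsLaw (ν : ℕ∞) (𝒜 : Finset (Fin K)) (n : ℕ) (a : Fin K) : Measure 𝓧 :=
  if ν ≤ n ∧ a ∈ 𝒜 then M.post a else M.pre a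

instance isProbabilityMeasure_obsLaw (ν : ℕ∞) (𝒜 : Finset (Fin K)) (n : ℕ) (a : Fin K) :
    IsProbabilityMeasure (M.obsLaw ν 𝒜 n a) := by
  unfold obsLaw; split_ifs <;> infer_instance

/-- `ℙ_{ν,𝒜}`: all observations are independent, and the actions in `𝒜` change at time `ν`. -/
def law (ν : ℕ∞) (𝒜 : Finset (Fin K)) : Measure (Path K 𝓧) :=
  Measure.infinitePi fun n : ℕ => Measure.pi fun a : Fin K => M.obsLaw ν 𝒜 n a

/-- `ℙ_∞`: no change ever occurs. -/
def lawNoChange : Measure (Path K 𝓧) := M.law ⊤ ∅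

/-- `𝓕_n = σ(X_{A_1,1}, …, X_{A_n,n})`, the information collected up to time `n` when the actions
are chosen by `A`. -/
abbrev history (A : ℕ → Path K 𝓧 → Fin K) (n : ℕ) : MeasurableSpace (Path K 𝓧) :=
  ⨆ i ∈ Finset.Icc 1 n,
    MeasurableSpace.comap (fun ω : Path K 𝓧 => ω i (A i ω)) inferInstance

/-- Control policies: the action at time `n` is a function of the observations made before. -/
def IsControlPolicy (A : ℕ → Path K 𝓧 → Fin K) : Prop :=
  ∀ n, 1 ≤ n → Measurable[history A (n - 1)] (A n)

/-- The first time step of the interval of length `W` that contains time `n ≥ 1`, that is,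
`(⌈n / W⌉ - 1) * W + 1`. -/
def windowStart (W n : ℕ) : ℕ := (n - 1) / W * W + 1

/-- The number of times action `a` has been selected in the current interval before time `n`. -/
def pulls (A : ℕ → Path K 𝓧 → Fin K) (W : ℕ) (a : Fin K) (n : ℕ) (ω : Path K 𝓧) : ℕ :=
  ((Finset.Ico (windowStart W n) n).filter fun i => A i ω = a).card

/-- The empirical mean of the rewards of action `a` in the current interval before time `n`
(used only when there is at least one such reward). -/
def meanReward (A : ℕ → Path K 𝓧 → Fin K) (W : ℕ) (a : Fin K) (n : ℕ) (ω : Path K 𝓧) : EReal :=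
  (∑ i ∈ (Finset.Ico (windowStart W n) n).filter (fun i => A i ω = a), M.LLR a (ω i a)) /
    ((pulls A W a n ω : ℝ) : EReal)

/-- The UCB index of action `a` with which the action at time `n` is chosen; it is `∞` if `a` has
not been selected yet in the current interval. -/
def ucbIndex (v : ℝ≥0) (A : ℕ → Path K 𝓧 → Fin K) (W : ℕ) (a : Fin K) (n : ℕ) (ω : Path K 𝓧) :
    EReal :=
  if pulls A W a n ω = 0 then ⊤
  else M.meanReward A W a n ω +
    ((Real.sqrt (4 * (v : ℝ) * Real.log W / (pulls A W a n ω : ℝ)) : ℝ) : EReal)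

/-- `A` is a UCB control policy restarted every `W` time steps: at each time it selects an action
of maximal UCB index (ties being broken in any way based on the past observations). -/
structure IsUCBPolicy (v : ℝ≥0) (W : ℕ) (A : ℕ → Path K 𝓧 → Fin K) : Prop where
  isControlPolicy : IsControlPolicy A
  argmax : ∀ n, 1 ≤ n → ∀ ω a, M.ucbIndex v A W a n ω ≤ M.ucbIndex v A W (A n ω) n ω

/-- The per-action CuSum statistic `C_{a,n}` under the policy `A`. -/
def cusum (A : ℕ → Path K 𝓧 → Fin K) (a : Fin K) : ℕ → Path K 𝓧 → EReal
  | 0, _ => 0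
  | n + 1, ω =>
    if A (n + 1) ω = a then max (cusum A a n ω) 0 + M.LLR a (ω (n + 1) a)
    else cusum A a n ω

/-- The first time `n ≥ 1` at which one of the per-action CuSum statistics reaches the threshold
`b` (`⊤` if there is none). -/
def alarm (A : ℕ → Path K 𝓧 → Fin K) (b : ℝ) (ω : Path K 𝓧) : ℕ∞ :=
  sInf {t : ℕ∞ | ∃ n : ℕ, 1 ≤ n ∧ (∃ a, (b : EReal) ≤ M.cusum A a n ω) ∧ t = n}

/-- The mean time to false alarm `𝔼_∞[T]`. -/
def meanTimeToFalseAlarm (T : Path K 𝓧 → ℕ∞) : ℝ≥0∞ :=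
  ∫⁻ ω, ((T ω : ℕ∞) : ℝ≥0∞) ∂M.lawNoChange

/-- Lorden's worst-case expected detection delay
`sup_{ν ≥ 1} ess sup 𝔼_{ν,𝒜}[(T - ν + 1)⁺ | 𝓕_{ν-1}]`. -/
def worstCaseDelay (𝒜 : Finset (Fin K)) (A : ℕ → Path K 𝓧 → Fin K) (T : Path K 𝓧 → ℕ∞) : ℝ≥0∞ :=
  ⨆ (ν : ℕ) (_ : 1 ≤ ν),
    essSup (condLExp (history A (ν - 1)) (M.law ν 𝒜)
      (fun ω => ((T ω + 1 - (ν : ℕ∞) : ℕ∞) : ℝ≥0∞))) (M.law ν 𝒜)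

/-- `I_𝒜`, the largest divergence among the affected actions. -/
def maxKL (𝒜 : Finset (Fin K)) (h𝒜 : 𝒜.Nonempty) : ℝ := 𝒜.sup' h𝒜 M.KL

end

end BanditQCD

/-! False alarms. For each action, exponentiated CuSum is a maximum over restart times of products
of likelihood ratios, and the Shiryaev-Roberts statistic `shiryaevRoberts` is the corresponding sum,
so it dominates whenever CuSum is positive. Only one action is sampled per step, and a likelihood
ratio has mean at most one before the change. Hence the sum of these statistics over all actions,
minus `n`, is a supermartingale under `lawNoChange`, for any control policy. It is at least `γ` at
an alarm when `1 < γ`, so stopping it there gives mean time at least `γ`; no factor `K` is lost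
(`mul_measure_alarm_le_add_lintegral_le`).

Delay. Time is cut into the restart intervals. Restarting makes the policy forget data from before
the change, so in every interval that starts after it the usual UCB analysis holds conditionally on
any past event: the best affected action is missed `O(log W)` times in expectation
(`Regular.exists_le_sum_measure_selected`). Affected actions are sub-Gaussian. For an unaffected
action nothing is assumed about tails; that its likelihood ratio has mean at most one already rules
out a large empirical mean log-likelihood ratio.

A Wald-type argument then bounds the number of intervals survived. Each interval adds in expectation
nearly `W` times the divergence to the CuSum of the best action, whose value just before each
surviving interval is below `b`. Rewards are truncated at `B`, so the last surviving interval
overshoots by at most `B * W`. This gives a delay of at most `W + (b + B * W) / y` for `y` slightly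
below the divergence (`Regular.worstCaseDelay_alarm_le`), uniformly in the change time and the past.
Since `W → ∞` makes `log W / W` vanish and `W = o(b)`, the bound is `b / y` to first order, and `y`
can be taken arbitrarily close to the divergence. -/

namespace BanditQCD

/-! ### Measurability with respect to the observed and the full history. -/

section History

variable {K : ℕ} {𝓧 : Type*} [MeasurableSpace 𝓧] {A : ℕ → Path K 𝓧 → Fin K}

lemma history_mono (A : ℕ → Path K 𝓧 → Fin K) {m n : ℕ} (h : m ≤ n) :
    history A m ≤ history A n :=
  biSup_mono fun i hi => by
    rw [Finset.mem_Icc] at hi ⊢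
    exact ⟨hi.1, hi.2.trans h⟩

/-- The σ-algebra generated by all channels up to time `n`. -/
abbrev fullHistory (K : ℕ) (𝓧 : Type*) [MeasurableSpace 𝓧] (n : ℕ) : MeasurableSpace (Path K 𝓧) :=
  ⨆ i ∈ Set.Iic n, MeasurableSpace.comap (fun ω : Path K 𝓧 => ω i) inferInstance

lemma fullHistory_mono {m n : ℕ} (h : m ≤ n) : fullHistory K 𝓧 m ≤ fullHistory K 𝓧 n :=
  biSup_mono fun _ hi => le_trans hi h

lemma fullHistory_le (n : ℕ) : fullHistory K 𝓧 n ≤ (inferInstance : MeasurableSpace (Path K 𝓧)) :=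
  iSup₂_le fun i _ => (measurable_pi_apply i).comap_le

lemma measurable_apply_selected {m : MeasurableSpace (Path K 𝓧)} {i : ℕ}
    (hA : Measurable[m] (A i)) (hX : Measurable[m] fun ω : Path K 𝓧 => ω i) :
    Measurable[m] fun ω : Path K 𝓧 => ω i (A i ω) := by
  intro s hs
  have : (fun ω : Path K 𝓧 => ω i (A i ω)) ⁻¹' s
      = ⋃ a, (A i ⁻¹' {a} ∩ (fun ω : Path K 𝓧 => ω i) ⁻¹' ((fun x => x a) ⁻¹' s)) := by
    ext ω; simp
  rw [this]
  exact MeasurableSet.iUnion fun a =>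
    (hA (measurableSet_singleton a)).inter (hX (measurable_pi_apply a hs))

/-- Strong induction is forced: which coordinate is observed at time `i` depends on the observed
history up to `i - 1`. The larger σ-algebra is the one for which independence of the next
observation is immediate. -/
lemma IsControlPolicy.history_le_fullHistory (hA : IsControlPolicy A) (n : ℕ) :
    history A n ≤ fullHistory K 𝓧 n := by
  induction n using Nat.strong_induction_on with
  | _ n ih =>
    refine iSup₂_le fun i hi => ?_
    rw [Finset.mem_Icc] at hi
    refine Measurable.comap_le (measurable_apply_selected ?_ ?_)
    · exact ((hA i hi.1).mono (ih (i - 1) (by omega)) le_rfl).mono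
        (fullHistory_mono (by omega)) le_rfl
    · exact Measurable.of_comap_le
        (le_iSup₂_of_le (f := fun i (_ : i ∈ Set.Iic n) => MeasurableSpace.comap
          (fun ω : Path K 𝓧 => ω i) inferInstance) i hi.2 le_rfl)

lemma IsControlPolicy.history_le (hA : IsControlPolicy A) (n : ℕ) :
    history A n ≤ (inferInstance : MeasurableSpace (Path K 𝓧)) :=
  (hA.history_le_fullHistory n).trans (fullHistory_le n)

lemma IsControlPolicy.measurable_action (hA : IsControlPolicy A) {i n : ℕ} (hi : 1 ≤ i)
    (hin : i ≤ n + 1) : Measurable[history A n] (A i) :=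
  (hA i hi).mono (history_mono A (by omega)) le_rfl

lemma IsControlPolicy.measurableSet_action_eq (hA : IsControlPolicy A) {i n : ℕ} (hi : 1 ≤ i)
    (hin : i ≤ n + 1) (a : Fin K) : MeasurableSet[history A n] {ω | A i ω = a} :=
  hA.measurable_action hi hin (measurableSet_singleton a)

/-- The coordinate `ω i a` alone need not be observed; only on the event that `a` was selected does
it agree with the observation. -/
lemma IsControlPolicy.measurable_ite {β : Type*} [MeasurableSpace β] (hA : IsControlPolicy A)
    {i n : ℕ} (hi : 1 ≤ i) (hin : i ≤ n) (a : Fin K) {g : 𝓧 → β} (hg : Measurable g)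
    {u : Path K 𝓧 → β}
    (hu : Measurable[history A n] u) :
    Measurable[history A n] fun ω => if A i ω = a then g (ω i a) else u ω := by
  have h1 : (fun ω => if A i ω = a then g (ω i a) else u ω)
      = fun ω => if A i ω = a then g (ω i (A i ω)) else u ω := by
    ext ω; split_ifs with h <;> simp [h]
  rw [h1]
  refine Measurable.ite (hA.measurableSet_action_eq hi (by omega) a) ?_ hu
  refine hg.comp (Measurable.of_comap_le ?_)
  exact le_iSup₂_of_le (f := fun i (_ : i ∈ Finset.Icc 1 n) => MeasurableSpace.comap
          (fun ω : Path K 𝓧 => ω i (A i ω)) inferInstance) i (Finset.mem_Icc.2 ⟨hi, hin⟩) le_rfl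

lemma IsControlPolicy.measurable_pulls (hA : IsControlPolicy A) (W : ℕ) (a : Fin K) {n : ℕ}
    (hn : 1 ≤ n) : Measurable[history A (n - 1)] (pulls A W a n) := by
  have : pulls A W a n = fun ω => ∑ i ∈ Finset.Ico (windowStart W n) n,
      if A i ω = a then 1 else 0 := by
    ext ω; rw [pulls, Finset.card_filter]
  rw [this]
  refine Finset.measurable_fun_sum _ fun i hi => ?_
  rw [Finset.mem_Ico, windowStart] at hi
  exact Measurable.ite (hA.measurableSet_action_eq (by omega) (by omega) a)
    measurable_const measurable_const

end History

/-! ### Independence of the current observation from the past. -/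

section Law

variable {K : ℕ} {𝓧 : Type*} [MeasurableSpace 𝓧] (M : BanditQCD K 𝓧)
  {A : ℕ → Path K 𝓧 → Fin K} (ν : ℕ∞) (𝒜 : Finset (Fin K))

instance isProbabilityMeasure_law : IsProbabilityMeasure (M.law ν 𝒜) := by
  unfold law; infer_instance

lemma measurePreserving_obs (n : ℕ) (a : Fin K) :
    MeasurePreserving (fun ω : Path K 𝓧 => ω n a) (M.law ν 𝒜) (M.obsLaw ν 𝒜 n a) :=
  (measurePreserving_eval (fun a => M.obsLaw ν 𝒜 n a) a).comp
    (measurePreserving_eval_infinitePi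
      (fun n : ℕ => Measure.pi fun a : Fin K => M.obsLaw ν 𝒜 n a) n)

lemma indep_fullHistory_obs {n : ℕ} (hn : 1 ≤ n) :
    Indep (fullHistory K 𝓧 (n - 1)) (MeasurableSpace.comap (fun ω : Path K 𝓧 => ω n) inferInstance)
      (M.law ν 𝒜) := by
  have h : iIndep (fun i => MeasurableSpace.comap (fun ω : Path K 𝓧 => ω i) inferInstance)
      (M.law ν 𝒜) :=
    iIndepFun_infinitePi (P := fun n : ℕ => Measure.pi fun a : Fin K => M.obsLaw ν 𝒜 n a)
      (X := fun _ x => x) (fun _ => measurable_id)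
  have := indep_iSup_of_disjoint (fun i => (measurable_pi_apply i).comap_le) h
    (S := Set.Iic (n - 1)) (T := {n}) (by simp; omega)
  rwa [iSup_singleton] at this

variable {ν 𝒜}

lemma indep_history_obs (hA : IsControlPolicy A) {n : ℕ} (hn : 1 ≤ n) :
    Indep (history A (n - 1)) (MeasurableSpace.comap (fun ω : Path K 𝓧 => ω n) inferInstance)
      (M.law ν 𝒜) :=
  indep_of_indep_of_le_left (M.indep_fullHistory_obs ν 𝒜 hn) (hA.history_le_fullHistory _)

lemma lintegral_mul_obs (hA : IsControlPolicy A) {n : ℕ} (hn : 1 ≤ n) (a : Fin K)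
    {F : Path K 𝓧 → ℝ≥0∞} (hF : Measurable[history A (n - 1)] F) {g : 𝓧 → ℝ≥0∞}
    (hg : Measurable g) :
    ∫⁻ ω, F ω * g (ω n a) ∂(M.law ν 𝒜)
      = (∫⁻ ω, F ω ∂(M.law ν 𝒜)) * ∫⁻ x, g x ∂(M.obsLaw ν 𝒜 n a) := by
  rw [lintegral_mul_eq_lintegral_mul_lintegral_of_independent_measurableSpace
    (hA.history_le (n - 1)) (measurable_pi_apply n).comap_le (M.indep_history_obs hA hn) hF
    (g := fun ω => g (ω n a)), (M.measurePreserving_obs ν 𝒜 n a).lintegral_comp hg]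
  exact (hg.comp (measurable_pi_apply a)).comp (comap_measurable fun ω : Path K 𝓧 => ω n)

lemma setIntegral_obs (hA : IsControlPolicy A) {n : ℕ} (hn : 1 ≤ n) (a : Fin K)
    {E : Set (Path K 𝓧)} (hE : MeasurableSet[history A (n - 1)] E) {φ : 𝓧 → ℝ}
    (hφ : Measurable φ) :
    ∫ ω in E, φ (ω n a) ∂(M.law ν 𝒜)
      = (M.law ν 𝒜).real E * ∫ x, φ x ∂(M.obsLaw ν 𝒜 n a) := by
  have hE' := hA.history_le (n - 1) E hE
  have hX : Measurable fun ω : Path K 𝓧 => ω n a :=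
    (measurable_pi_apply a).comp (measurable_pi_apply n)
  have hind : IndepFun (E.indicator fun _ => (1 : ℝ)) (fun ω : Path K 𝓧 => φ (ω n a))
      (M.law ν 𝒜) := by
    refine indep_of_indep_of_le_left (indep_of_indep_of_le_right (M.indep_history_obs hA hn) ?_) ?_
    · exact Measurable.comap_le ((hφ.comp (measurable_pi_apply a :
        Measurable fun x : Fin K → 𝓧 => x a)).comp (comap_measurable fun ω : Path K 𝓧 => ω n))
    · exact Measurable.comap_le (measurable_const.indicator hE)
  have h := hind.integral_fun_mul_eq_mul_integral
    (measurable_const.indicator hE').aestronglyMeasurable (hφ.comp hX).aestronglyMeasurable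
  rw [integral_indicator hE', setIntegral_const, smul_eq_mul, mul_one] at h
  rw [← integral_indicator hE', ← (M.measurePreserving_obs ν 𝒜 n a).map_eq,
    integral_map hX.aemeasurable hφ.aestronglyMeasurable, ← h]
  refine integral_congr_ae (ae_of_all _ fun ω => ?_)
  by_cases hω : ω ∈ E <;> simp [hω]

end Law

/-! ### The CuSum statistics and the alarm as a stopping time. -/

section Alarm

variable {K : ℕ} {𝓧 : Type*} [MeasurableSpace 𝓧] (M : BanditQCD K 𝓧)
  {A : ℕ → Path K 𝓧 → Fin K}

lemma measurable_likelihoodRatio (a : Fin K) : Measurable fun x => M.f₁ a x / M.f₀ a x :=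
  (M.measurable_f₁ a).div (M.measurable_f₀ a)

lemma measurable_LLR (a : Fin K) : Measurable (M.LLR a) :=
  (M.measurable_likelihoodRatio a).ennreal_log

lemma exp_LLR (a : Fin K) (x : 𝓧) : (M.LLR a x).exp = M.f₁ a x / M.f₀ a x :=
  ENNReal.exp_log _

lemma measurable_cusum (hA : IsControlPolicy A) (a : Fin K) (n : ℕ) :
    Measurable[history A n] (M.cusum A a n) := by
  induction n with
  | zero => exact measurable_const
  | succ n ih =>
    have ih' := ih.mono (history_mono A (Nat.le_succ n)) le_rfl
    have hs := hA.measurableSet_action_eq (i := n + 1) (n := n + 1) (by omega) (by omega) a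
    have h1 := hA.measurable_ite (i := n + 1) (n := n + 1) (by omega) le_rfl a (M.measurable_LLR a)
      (measurable_const (a := (0 : EReal)))
    -- The increment is guarded by a second, redundant test so that it becomes history-measurable by
    -- itself.
    have h2 : M.cusum A a (n + 1) = fun ω => if A (n + 1) ω = a then
        max (M.cusum A a n ω) 0 + (if A (n + 1) ω = a then M.LLR a (ω (n + 1) a) else 0)
        else M.cusum A a n ω := by
      ext ω; rw [cusum]; split_ifs <;> rfl
    rw [h2]
    exact Measurable.ite hs (Measurable.add (Measurable.max ih' measurable_const) h1) ih'

lemma lt_alarm_iff {b : ℝ} {ω : Path K 𝓧} {n : ℕ} :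
    (n : ℕ∞) < M.alarm A b ω ↔ ∀ m, 1 ≤ m → m ≤ n → ∀ a, M.cusum A a m ω < b := by
  constructor
  · intro h m hm hmn a
    by_contra! hc
    have : M.alarm A b ω ≤ m := sInf_le ⟨m, hm, ⟨a, hc⟩, rfl⟩
    exact absurd (h.trans_le this) (by simpa using hmn)
  · intro h
    have : ((n + 1 : ℕ) : ℕ∞) ≤ M.alarm A b ω := by
      refine le_sInf ?_
      rintro t ⟨m, hm, ⟨a, ha⟩, rfl⟩
      by_contra! hc
      have hmn : m < n + 1 := by exact_mod_cast hc
      exact absurd ha (not_le.2 (h m hm (by omega) a))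
    exact lt_of_lt_of_le (by exact_mod_cast Nat.lt_succ_self n) this

lemma measurableSet_lt_alarm (hA : IsControlPolicy A) (b : ℝ) (n : ℕ) :
    MeasurableSet[history A n] {ω | (n : ℕ∞) < M.alarm A b ω} := by
  have : {ω | (n : ℕ∞) < M.alarm A b ω}
      = ⋂ m ∈ Finset.Icc 1 n, ⋂ a, {ω | M.cusum A a m ω < b} := by
    ext ω
    simp only [Set.mem_ofPred_eq, lt_alarm_iff, Set.mem_iInter, Finset.mem_Icc, and_imp]
  rw [this]
  refine Finset.measurableSet_biInter _ fun m hm => MeasurableSet.iInter fun a => ?_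
  rw [Finset.mem_Icc] at hm
  exact ((M.measurable_cusum hA a m).mono (history_mono A hm.2) le_rfl) measurableSet_Iio

lemma sum_indicator_lt_le (t : ℕ∞) (m : ℕ) :
    ∑ n ∈ Finset.range m, (if (n : ℕ∞) < t then (1 : ℝ≥0∞) else 0) ≤ (t : ℝ≥0∞) := by
  rw [Finset.sum_ite, Finset.sum_const_zero, add_zero, Finset.sum_const, nsmul_eq_mul, mul_one]
  induction t using ENat.recTopCoe with
  | top => simp
  | coe t =>
    have : ((Finset.range m).filter fun n : ℕ => (n : ℕ∞) < t).card ≤ t := by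
      calc _ ≤ (Finset.range t).card := Finset.card_le_card fun n hn => by
            simp only [Finset.mem_filter, Nat.cast_lt] at hn; simpa using hn.2
        _ = t := Finset.card_range t
    simpa using this

end Alarm

/-! ### Mean time to false alarm by a Shiryaev-Roberts supermartingale. -/

section FalseAlarm

variable {K : ℕ} {𝓧 : Type*} [MeasurableSpace 𝓧] (M : BanditQCD K 𝓧)
  {A : ℕ → Path K 𝓧 → Fin K}

/-- The Shiryaev-Roberts statistic of action `a` under the policy `A`. -/
noncomputable def shiryaevRoberts (A : ℕ → Path K 𝓧 → Fin K) (a : Fin K) :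
    ℕ → Path K 𝓧 → ℝ≥0∞
  | 0, _ => 0
  | n + 1, ω =>
    if A (n + 1) ω = a then
      (1 + shiryaevRoberts A a n ω) * (M.f₁ a (ω (n + 1) a) / M.f₀ a (ω (n + 1) a))
    else shiryaevRoberts A a n ω

lemma measurable_shiryaevRoberts (hA : IsControlPolicy A) (a : Fin K) (n : ℕ) :
    Measurable[history A n] (M.shiryaevRoberts A a n) := by
  induction n with
  | zero => exact measurable_const
  | succ n ih =>
    have ih' := ih.mono (history_mono A (Nat.le_succ n)) le_rfl
    have hs := hA.measurableSet_action_eq (i := n + 1) (n := n + 1) (by omega) (by omega) a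
    have h1 := hA.measurable_ite (i := n + 1) (n := n + 1) (by omega) le_rfl a
      (M.measurable_likelihoodRatio a) (measurable_const (a := (0 : ℝ≥0∞)))
    have h2 : M.shiryaevRoberts A a (n + 1) = fun ω => if A (n + 1) ω = a then
        (1 + M.shiryaevRoberts A a n ω) * (if A (n + 1) ω = a then
          M.f₁ a (ω (n + 1) a) / M.f₀ a (ω (n + 1) a) else 0)
        else M.shiryaevRoberts A a n ω := by
      ext ω; rw [shiryaevRoberts]; split_ifs <;> rfl
    rw [h2]
    exact Measurable.ite hs (Measurable.mul (Measurable.add measurable_const ih') h1) ih'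

/-- A maximum over restart times is at most the sum over them. The `1` covers the initial value zero
of the CuSum. -/
lemma exp_cusum_le (a : Fin K) (n : ℕ) (ω : Path K 𝓧) :
    (M.cusum A a n ω).exp ≤ max (M.shiryaevRoberts A a n ω) 1 := by
  induction n with
  | zero => simp [cusum]
  | succ n ih =>
    rw [cusum, shiryaevRoberts]
    split_ifs with h
    · rw [EReal.exp_add, exp_LLR, EReal.exp_monotone.map_max, EReal.exp_zero]
      refine le_max_of_le_left (mul_le_mul_left ?_ _)
      exact (max_le_max_right 1 ih).trans
        (max_le (max_le le_add_self le_self_add) le_self_add)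
    · exact ih

lemma ofReal_le_shiryaevRoberts {γ : ℝ} (hγ : 1 < γ) {a : Fin K} {n : ℕ} {ω : Path K 𝓧}
    (h : (Real.log γ : EReal) ≤ M.cusum A a n ω) :
    ENNReal.ofReal γ ≤ M.shiryaevRoberts A a n ω := by
  have h1 := (EReal.exp_monotone h).trans (M.exp_cusum_le a n ω)
  rw [EReal.exp_coe, Real.exp_log (by linarith)] at h1
  exact (le_max_iff.1 h1).resolve_right (by simpa using hγ)

/-- Only an inequality, since `f₁ a` may carry mass where `f₀ a` vanishes. -/
lemma lintegral_likelihoodRatio_pre_le (a : Fin K) :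
    ∫⁻ x, M.f₁ a x / M.f₀ a x ∂(M.pre a) ≤ 1 := by
  rw [pre, lintegral_withDensity_eq_lintegral_mul _ (M.measurable_f₀ a)
    (M.measurable_likelihoodRatio a), ← M.lintegral_f₁ a]
  exact lintegral_mono fun x => ENNReal.mul_div_le

/-- The drift of action `a` is at most the probability of selecting `a`. These events partition the
space, so the total drift on `E` is at most the measure of `E`, not `K` times it. -/
lemma setLIntegral_shiryaevRoberts_succ_le (hA : IsControlPolicy A) (n : ℕ)
    {E : Set (Path K 𝓧)} (hE : MeasurableSet[history A n] E) :
    ∫⁻ ω in E, ∑ a, M.shiryaevRoberts A a (n + 1) ω ∂M.lawNoChange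
      ≤ M.lawNoChange E + ∫⁻ ω in E, ∑ a, M.shiryaevRoberts A a n ω ∂M.lawNoChange := by
  have hE' := hA.history_le n E hE
  have hR : ∀ n a, Measurable (M.shiryaevRoberts A a n) := fun n a =>
    (M.measurable_shiryaevRoberts hA a n).mono (hA.history_le n) le_rfl
  have hs : ∀ a, MeasurableSet {ω | A (n + 1) ω = a} := fun a =>
    hA.history_le n _ (hA.measurableSet_action_eq (by omega) (by omega) a)
  have key : ∀ a, ∫⁻ ω in E, M.shiryaevRoberts A a (n + 1) ω ∂M.lawNoChange
      ≤ ∫⁻ ω in E, (if A (n + 1) ω = a then 1 else 0) + M.shiryaevRoberts A a n ω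
        ∂M.lawNoChange := by
    intro a
    set S := {ω | A (n + 1) ω = a} with hS
    have hSm : MeasurableSet[history A n] S := hA.measurableSet_action_eq (by omega) (by omega) a
    set F : Path K 𝓧 → ℝ≥0∞ := (E ∩ S).indicator fun ω => 1 + M.shiryaevRoberts A a n ω
    have hF : Measurable[history A n] F :=
      (Measurable.add measurable_const (M.measurable_shiryaevRoberts hA a n)).indicator
        (hE.inter hSm)
    have hlaw : M.obsLaw ⊤ ∅ (n + 1) a = M.pre a := by simp [obsLaw]
    have h1 : ∫⁻ ω, F ω * (M.f₁ a (ω (n + 1) a) / M.f₀ a (ω (n + 1) a)) ∂M.lawNoChange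
        ≤ ∫⁻ ω, F ω ∂M.lawNoChange := by
      rw [lawNoChange, M.lintegral_mul_obs hA (n := n + 1) (by omega) a hF
        (M.measurable_likelihoodRatio a), hlaw]
      exact mul_le_of_le_one_right' (M.lintegral_likelihoodRatio_pre_le a)
    set G : Path K 𝓧 → ℝ≥0∞ := (E ∩ Sᶜ).indicator (M.shiryaevRoberts A a n)
    have hG : Measurable G := (hR n a).indicator (hE'.inter (hs a).compl)
    rw [← lintegral_indicator hE', ← lintegral_indicator hE']
    calc _ = ∫⁻ ω, G ω + F ω * (M.f₁ a (ω (n + 1) a) / M.f₀ a (ω (n + 1) a)) ∂M.lawNoChange := by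
          refine lintegral_congr fun ω => ?_
          by_cases hω : ω ∈ E <;> by_cases hω' : A (n + 1) ω = a <;>
            simp [F, G, S, hω, hω', shiryaevRoberts]
      _ ≤ ∫⁻ ω, G ω + F ω ∂M.lawNoChange := by
          rw [lintegral_add_left hG, lintegral_add_left hG]
          gcongr
      _ = _ := by
          refine lintegral_congr fun ω => ?_
          by_cases hω : ω ∈ E <;> by_cases hω' : A (n + 1) ω = a <;>
            simp [F, G, S, hω, hω']
  have hone : M.lawNoChange E = ∫⁻ ω in E, ∑ a, (if A (n + 1) ω = a then 1 else 0)
      ∂M.lawNoChange := by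
    simp
  rw [hone, lintegral_finsetSum _ fun a _ => hR (n + 1) a,
    ← lintegral_add_right _ (Finset.measurable_fun_sum _ fun a _ => hR n a)]
  simp_rw [← Finset.sum_add_distrib]
  rw [lintegral_finsetSum]
  · exact Finset.sum_le_sum fun a _ => key a
  · exact fun a _ => (Measurable.ite (hs a) measurable_const measurable_const).add (hR n a)

/-- Optional stopping at the minimum of the alarm and `m`. The right side is the mean of that
minimum, and the integral on the left is the part not yet stopped, needed for the induction. -/
lemma mul_measure_alarm_le_add_lintegral_le (hA : IsControlPolicy A) {γ : ℝ} (hγ : 1 < γ)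
    (m : ℕ) :
    ENNReal.ofReal γ * M.lawNoChange {ω | M.alarm A (Real.log γ) ω ≤ m}
      + ∫⁻ ω in {ω | (m : ℕ∞) < M.alarm A (Real.log γ) ω}, ∑ a, M.shiryaevRoberts A a m ω
        ∂M.lawNoChange
      ≤ ∑ n ∈ Finset.range m, M.lawNoChange {ω | (n : ℕ∞) < M.alarm A (Real.log γ) ω} := by
  set T := M.alarm A (Real.log γ)
  have hT : ∀ n : ℕ, MeasurableSet[history A n] {ω | (n : ℕ∞) < T ω} :=
    M.measurableSet_lt_alarm hA _
  have hT' : ∀ n : ℕ, MeasurableSet {ω | (n : ℕ∞) < T ω} := fun n => hA.history_le n _ (hT n)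
  induction m with
  | zero =>
    have h0 : {ω | T ω ≤ (0 : ℕ)} = ∅ := by
      ext ω
      simp only [Set.mem_ofPred_eq, Set.mem_empty_iff_false, iff_false, not_le]
      exact M.lt_alarm_iff.2 fun m h1 h2 => absurd h1 (by omega)
    rw [h0]
    simp [shiryaevRoberts]
  | succ m ih =>
    rw [Finset.sum_range_succ]
    have hsub : {ω | ((m + 1 : ℕ) : ℕ∞) < T ω} ⊆ {ω | (m : ℕ∞) < T ω} := fun ω h =>
      lt_trans (by exact_mod_cast Nat.lt_succ_self m) (show ((m + 1 : ℕ) : ℕ∞) < T ω from h)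
    -- The event that the alarm is raised exactly at time `m + 1`.
    set D := {ω | (m : ℕ∞) < T ω} \ {ω | ((m + 1 : ℕ) : ℕ∞) < T ω} with hD
    have hDm : MeasurableSet D := (hT' m).diff (hT' (m + 1))
    have hle : {ω | T ω ≤ (m + 1 : ℕ)} = {ω | T ω ≤ m} ∪ D := by
      ext ω
      simp only [D, Set.mem_ofPred_eq, Set.mem_union, Set.mem_sdiff, not_lt]
      constructor
      · intro h
        rcases le_or_gt (T ω) m with h' | h'
        · exact Or.inl h'
        · exact Or.inr ⟨h', h⟩
      · rintro (h | h)
        · exact h.trans (by exact_mod_cast Nat.le_succ m)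
        · exact h.2
    have hγD : ENNReal.ofReal γ * M.lawNoChange D
        ≤ ∫⁻ ω in D, ∑ a, M.shiryaevRoberts A a (m + 1) ω ∂M.lawNoChange := by
      rw [← setLIntegral_const]
      refine setLIntegral_mono' hDm fun ω hω => ?_
      obtain ⟨h1, h2⟩ := hω
      have h1' := M.lt_alarm_iff.1 h1
      simp only [Set.mem_ofPred_eq, T, lt_alarm_iff, not_forall, not_lt] at h2
      obtain ⟨k, hk1, hk2, a, ha⟩ := h2
      have hk : k = m + 1 := by
        by_contra hne
        exact absurd ha (not_le.2 (h1' k hk1 (by omega) a))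
      subst hk
      exact (M.ofReal_le_shiryaevRoberts hγ ha).trans
        (Finset.single_le_sum (f := fun a => M.shiryaevRoberts A a (m + 1) ω)
          (fun _ _ => zero_le) (Finset.mem_univ a))
    have hsplit : ∫⁻ ω in {ω | (m : ℕ∞) < T ω}, ∑ a, M.shiryaevRoberts A a (m + 1) ω
          ∂M.lawNoChange
        = (∫⁻ ω in {ω | ((m + 1 : ℕ) : ℕ∞) < T ω}, ∑ a, M.shiryaevRoberts A a (m + 1) ω
          ∂M.lawNoChange)
          + ∫⁻ ω in D, ∑ a, M.shiryaevRoberts A a (m + 1) ω ∂M.lawNoChange := by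
      rw [← lintegral_union hDm Set.disjoint_sdiff_right, Set.union_sdiff_cancel hsub]
    calc _ ≤ ENNReal.ofReal γ * (M.lawNoChange {ω | T ω ≤ m} + M.lawNoChange D)
          + ∫⁻ ω in {ω | ((m + 1 : ℕ) : ℕ∞) < T ω}, ∑ a, M.shiryaevRoberts A a (m + 1) ω
            ∂M.lawNoChange := by
          rw [hle]; gcongr; exact measure_union_le _ _
      _ ≤ ENNReal.ofReal γ * M.lawNoChange {ω | T ω ≤ m}
          + ∫⁻ ω in {ω | (m : ℕ∞) < T ω}, ∑ a, M.shiryaevRoberts A a (m + 1) ω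
            ∂M.lawNoChange := by
          rw [hsplit, mul_add, add_assoc, add_comm (∫⁻ ω in _, _ ∂_) (∫⁻ ω in D, _ ∂_)]
          gcongr
      _ ≤ ENNReal.ofReal γ * M.lawNoChange {ω | T ω ≤ m}
          + (M.lawNoChange {ω | (m : ℕ∞) < T ω}
          + ∫⁻ ω in {ω | (m : ℕ∞) < T ω}, ∑ a, M.shiryaevRoberts A a m ω ∂M.lawNoChange) := by
          gcongr
          exact M.setLIntegral_shiryaevRoberts_succ_le hA m (hT m)
      _ ≤ _ := by
          rw [add_comm (M.lawNoChange _) (∫⁻ ω in _, _ ∂_), ← add_assoc]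
          gcongr

theorem ofReal_le_meanTimeToFalseAlarm (hA : IsControlPolicy A) (γ : ℝ) :
    ENNReal.ofReal γ ≤ M.meanTimeToFalseAlarm (M.alarm A (Real.log γ)) := by
  set T := M.alarm A (Real.log γ)
  have : IsProbabilityMeasure M.lawNoChange := by unfold lawNoChange; infer_instance
  have hT : ∀ n : ℕ, MeasurableSet {ω | (n : ℕ∞) < T ω} := fun n =>
    hA.history_le n _ (M.measurableSet_lt_alarm hA _ n)
  have hsum : ∀ m, ∑ n ∈ Finset.range m, M.lawNoChange {ω | (n : ℕ∞) < T ω}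
      ≤ M.meanTimeToFalseAlarm T := by
    intro m
    calc _ = ∫⁻ ω, ∑ n ∈ Finset.range m, (if (n : ℕ∞) < T ω then (1 : ℝ≥0∞) else 0)
          ∂M.lawNoChange := by
          rw [lintegral_finsetSum _ fun n _ =>
            Measurable.ite (hT n) measurable_const measurable_const]
          refine Finset.sum_congr rfl fun n _ => ?_
          rw [← lintegral_indicator_one (hT n)]
          refine lintegral_congr fun ω => ?_
          by_cases h : (n : ℕ∞) < T ω <;> simp [h]
      _ ≤ _ := lintegral_mono fun ω => sum_indicator_lt_le _ _
  -- For `γ ≤ 1` the threshold is nonpositive and the comparison with Shiryaev-Roberts is void, but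
  -- the alarm time is at least one.
  rcases le_or_gt γ 1 with hγ | hγ
  · refine (ENNReal.ofReal_le_one.2 hγ).trans (le_trans ?_ (hsum 1))
    have : {ω | ((0 : ℕ) : ℕ∞) < T ω} = Set.univ := Set.eq_univ_of_forall fun ω =>
      M.lt_alarm_iff.2 fun m h1 h2 => absurd h1 (by omega)
    rw [Finset.sum_range_one, this, measure_univ]
  -- If the alarm is almost surely finite, let `m → ∞` in the stopped inequality; otherwise the mean
  -- is infinite.
  by_cases htop : M.lawNoChange {ω | T ω = ⊤} = 0
  · have hmono : Monotone fun m : ℕ => {ω | T ω ≤ (m : ℕ∞)} := fun i j hij ω h =>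
      le_trans (show T ω ≤ i from h) (by exact_mod_cast hij)
    have hunion : (⋃ m : ℕ, {ω | T ω ≤ (m : ℕ∞)}) = {ω | T ω = ⊤}ᶜ := by
      ext ω
      simp only [Set.mem_iUnion, Set.mem_ofPred_eq, Set.mem_compl_iff]
      constructor
      · rintro ⟨m, hm⟩ h
        rw [h] at hm
        exact absurd hm (by simp)
      · intro h
        lift T ω to ℕ using h with t
        exact ⟨t, le_rfl⟩
    have hone : M.lawNoChange (⋃ m : ℕ, {ω | T ω ≤ (m : ℕ∞)}) = 1 := by
      rw [hunion]
      refine (prob_compl_eq_one_iff₀ ?_).2 htop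
      exact NullMeasurableSet.of_null htop
    have hlim := tendsto_measure_iUnion_atTop (μ := M.lawNoChange) hmono
    rw [hone] at hlim
    have hlim' := ENNReal.Tendsto.const_mul (a := ENNReal.ofReal γ) hlim (Or.inl one_ne_zero)
    rw [mul_one] at hlim'
    refine le_of_tendsto' hlim' fun m => ?_
    exact (le_trans le_self_add (M.mul_measure_alarm_le_add_lintegral_le hA hγ m)).trans (hsum m)
  · have h : (⊤ : ℝ≥0∞) ≤ M.meanTimeToFalseAlarm T := by
      have h1 : ∫⁻ ω in {ω | T ω = ⊤}, (⊤ : ℝ≥0∞) ∂M.lawNoChange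
          ≤ M.meanTimeToFalseAlarm T := by
        refine le_trans ?_ (setLIntegral_le_lintegral {ω | T ω = ⊤} _)
        have hm : MeasurableSet {ω | T ω = ⊤} := by
          have : {ω | T ω = ⊤} = ⋂ n : ℕ, {ω | (n : ℕ∞) < T ω} := by
            ext ω
            simp only [Set.mem_ofPred_eq, Set.mem_iInter]
            exact ⟨fun h n => by rw [h]; exact ENat.natCast_lt_top n,
              fun h => ENat.eq_top_iff_forall_gt.2 h⟩
          rw [this]
          exact MeasurableSet.iInter hT
        exact setLIntegral_mono' hm fun ω hω => by
          rw [Set.mem_ofPred_eq] at hω; simp [hω]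
      rwa [setLIntegral_const, ENNReal.top_mul htop] at h1
    exact le_trans le_top h

end FalseAlarm

end BanditQCD

lemma ENNReal.le_exp_neg_mul_of_exp_mul_le {x : ℝ} {p q : ℝ≥0∞}
    (h : ENNReal.ofReal (Real.exp x) * p ≤ q) : p ≤ ENNReal.ofReal (Real.exp (-x)) * q := by
  calc p = ENNReal.ofReal (Real.exp (-x)) * (ENNReal.ofReal (Real.exp x) * p) := by
        rw [← mul_assoc, ← ENNReal.ofReal_mul (Real.exp_pos _).le, ← Real.exp_add]; simp
    _ ≤ _ := by gcongr

namespace BanditQCD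

/-! ### Exponential moments of the log-likelihood ratio. -/

section Moments

variable {K : ℕ} {𝓧 : Type*} [MeasurableSpace 𝓧] {M : BanditQCD K 𝓧} {v : ℝ≥0}

lemma ae_pre_f₀_ne_zero (M : BanditQCD K 𝓧) (a : Fin K) : ∀ᵐ x ∂(M.pre a), M.f₀ a x ≠ 0 :=
  (ae_withDensity_iff (M.measurable_f₀ a)).2 (ae_of_all _ fun _ h => h)

lemma ae_pre_f₀_ne_top (M : BanditQCD K 𝓧) (a : Fin K) : ∀ᵐ x ∂(M.pre a), M.f₀ a x ≠ ⊤ :=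
  (withDensity_absolutelyContinuous _ _).ae_le
    ((ae_lt_top (M.measurable_f₀ a) (by simp [M.lintegral_f₀ a])).mono fun _ h => h.ne)

lemma ae_post_f₁_ne_zero (M : BanditQCD K 𝓧) (a : Fin K) : ∀ᵐ x ∂(M.post a), M.f₁ a x ≠ 0 :=
  (ae_withDensity_iff (M.measurable_f₁ a)).2 (ae_of_all _ fun _ h => h)

lemma ae_post_f₁_ne_top (M : BanditQCD K 𝓧) (a : Fin K) : ∀ᵐ x ∂(M.post a), M.f₁ a x ≠ ⊤ :=
  (withDensity_absolutelyContinuous _ _).ae_le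
    ((ae_lt_top (M.measurable_f₁ a) (by simp [M.lintegral_f₁ a])).mono fun _ h => h.ne)

lemma Regular.ae_coe_toReal_LLR (hM : M.Regular v) (a : Fin K) :
    ∀ᵐ x ∂(M.post a), ((M.LLR a x).toReal : EReal) = M.LLR a x := by
  filter_upwards [M.ae_post_f₁_ne_zero a, M.ae_post_f₁_ne_top a,
    (hM.ac a).ae_le (M.ae_pre_f₀_ne_zero a), (hM.ac a).ae_le (M.ae_pre_f₀_ne_top a)]
    with x h1 h2 h3 h4
  refine EReal.coe_toReal ?_ ?_
  · rw [LLR, Ne, ENNReal.log_eq_top_iff]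
    exact ENNReal.div_ne_top h2 h3
  · rw [LLR, Ne, ENNReal.log_eq_bot_iff]
    exact ENNReal.div_ne_zero.2 ⟨h1, h4⟩

lemma measurable_toReal_LLR (M : BanditQCD K 𝓧) (a : Fin K) :
    Measurable fun x => (M.LLR a x).toReal :=
  (M.measurable_LLR a).ereal_toReal

lemma Regular.lintegral_exp_le (hM : M.Regular v) (a : Fin K) (t : ℝ) :
    ∫⁻ x, ENNReal.ofReal (Real.exp (t * ((M.LLR a x).toReal - M.KL a))) ∂(M.post a)
      ≤ ENNReal.ofReal (Real.exp (v * t ^ 2 / 2)) := by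
  rw [← ofReal_integral_eq_lintegral_ofReal ((hM.subGaussian a).integrable_exp_mul t)
    (ae_of_all _ fun x => (Real.exp_pos _).le)]
  exact ENNReal.ofReal_le_ofReal ((hM.subGaussian a).mgf_le t)

lemma Regular.lintegral_rpow_post_le (hM : M.Regular v) (a : Fin K) (t : ℝ) :
    ∫⁻ x, (M.f₁ a x / M.f₀ a x) ^ t ∂(M.post a)
      ≤ ENNReal.ofReal (Real.exp (t * (M.KL a + v * t / 2))) := by
  have h : ∫⁻ x, (M.f₁ a x / M.f₀ a x) ^ t ∂(M.post a)
      = ∫⁻ x, ENNReal.ofReal (Real.exp (t * M.KL a))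
        * ENNReal.ofReal (Real.exp (t * ((M.LLR a x).toReal - M.KL a))) ∂(M.post a) := by
    refine lintegral_congr_ae ?_
    filter_upwards [hM.ae_coe_toReal_LLR a] with x hx
    rw [← exp_LLR, ← hx, EReal.exp_coe, ENNReal.ofReal_rpow_of_pos (Real.exp_pos _),
      ← ENNReal.ofReal_mul (Real.exp_pos _).le, ← Real.exp_add, ← Real.exp_mul, EReal.toReal_coe]
    ring_nf
  have hmeas : Measurable fun x =>
      ENNReal.ofReal (Real.exp (t * ((M.LLR a x).toReal - M.KL a))) := by
    have := M.measurable_toReal_LLR a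
    fun_prop
  rw [h, lintegral_const_mul _ hmeas]
  refine (mul_le_mul_right (hM.lintegral_exp_le a t) _).trans ?_
  rw [← ENNReal.ofReal_mul (Real.exp_pos _).le, ← Real.exp_add]
  refine ENNReal.ofReal_le_ofReal (Real.exp_le_exp.2 ?_)
  nlinarith

lemma Regular.integrable_LLR (hM : M.Regular v) (a : Fin K) :
    Integrable (fun x => (M.LLR a x).toReal) (M.post a) := by
  refine ((hM.subGaussian a).integrable.add (integrable_const (M.KL a))).congr
    (ae_of_all _ fun x => ?_)
  simp

end Moments

/-! ### Chernoff bounds for empirical means over adaptively chosen times. -/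

section Concentration

variable {K : ℕ} {𝓧 : Type*} [MeasurableSpace 𝓧] {M : BanditQCD K 𝓧} {v : ℝ≥0}
  {A : ℕ → Path K 𝓧 → Fin K} {ν : ℕ∞} {𝒜 : Finset (Fin K)}

lemma obsLaw_of_mem {ν n : ℕ} (h : ν ≤ n) {a : Fin K} (ha : a ∈ 𝒜) :
    M.obsLaw ν 𝒜 n a = M.post a := by
  simp [obsLaw, h, ha]

lemma obsLaw_of_notMem {ν : ℕ∞} {n : ℕ} {a : Fin K} (ha : a ∉ 𝒜) :
    M.obsLaw ν 𝒜 n a = M.pre a := by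
  simp [obsLaw, ha]

/-- The product is a nonnegative supermartingale started at `s`: a step that selects `a` multiplies
by a factor of conditional mean at most one, any other step by one. Integrating over a past event
`E` plays the role of conditioning. -/
lemma setLIntegral_prod_selected_le (hA : IsControlPolicy A) {s : ℕ} (hs : 1 ≤ s) {a : Fin K}
    {g : 𝓧 → ℝ≥0∞} (hg : Measurable g) (hint : ∀ i, s ≤ i → ∫⁻ x, g x ∂(M.obsLaw ν 𝒜 i a) ≤ 1)
    {E : Set (Path K 𝓧)} (hE : MeasurableSet[history A (s - 1)] E) {n : ℕ} (hn : s ≤ n) :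
    ∫⁻ ω in E, ∏ i ∈ (Finset.Ico s n).filter (fun i => A i ω = a), g (ω i a) ∂(M.law ν 𝒜)
      ≤ M.law ν 𝒜 E := by
  have hE' := hA.history_le _ E hE
  simp_rw [Finset.prod_filter]
  have hmeas : ∀ n, s ≤ n → Measurable[history A (n - 1)] fun ω : Path K 𝓧 =>
      ∏ i ∈ Finset.Ico s n, if A i ω = a then g (ω i a) else 1 := fun n _ =>
    Finset.measurable_fun_prod _ fun i hi => by
      rw [Finset.mem_Ico] at hi
      exact hA.measurable_ite (by omega) (by omega) a hg measurable_const
  induction n, hn using Nat.le_induction with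
  | base => simp
  | succ n hn ih =>
    refine le_trans ?_ ih
    simp_rw [Finset.prod_Ico_succ_top hn]
    set F := fun ω : Path K 𝓧 => ∏ i ∈ Finset.Ico s n, if A i ω = a then g (ω i a) else 1
    have hF : Measurable[history A (n - 1)] F := hmeas n hn
    have hEn : MeasurableSet[history A (n - 1)] E := history_mono A (by omega) _ hE
    have hS : MeasurableSet[history A (n - 1)] {ω | A n ω = a} :=
      hA.measurableSet_action_eq (by omega) (by omega) a
    have h1 := hF.indicator (hEn.inter hS)
    have h2 := hF.indicator (hEn.inter hS.compl)
    rw [← lintegral_indicator hE', ← lintegral_indicator hE']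
    calc _ = ∫⁻ ω, (E ∩ {ω | A n ω = a}ᶜ).indicator F ω
          + (E ∩ {ω | A n ω = a}).indicator F ω * g (ω n a) ∂(M.law ν 𝒜) := by
          refine lintegral_congr fun ω => ?_
          by_cases hω : ω ∈ E <;> by_cases hω' : A n ω = a <;> simp [hω, hω', F]
      _ ≤ ∫⁻ ω, (E ∩ {ω | A n ω = a}ᶜ).indicator F ω
          + (E ∩ {ω | A n ω = a}).indicator F ω ∂(M.law ν 𝒜) := by
          rw [lintegral_add_left (h2.mono (hA.history_le _) le_rfl),
            lintegral_add_left (h2.mono (hA.history_le _) le_rfl),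
            M.lintegral_mul_obs hA (by omega) a h1 hg]
          gcongr
          exact mul_le_of_le_one_right' (hint n hn)
      _ = _ := by
          refine lintegral_congr fun ω => ?_
          by_cases hω : ω ∈ E <;> by_cases hω' : A n ω = a <;> simp [hω, hω', F]

lemma mul_measure_inter_le (hA : IsControlPolicy A) {s : ℕ} (hs : 1 ≤ s) {a : Fin K}
    {g : 𝓧 → ℝ≥0∞} (hg : Measurable g) (hint : ∀ i, s ≤ i → ∫⁻ x, g x ∂(M.obsLaw ν 𝒜 i a) ≤ 1)
    {E : Set (Path K 𝓧)} (hE : MeasurableSet[history A (s - 1)] E) {n : ℕ} (hn : s ≤ n)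
    {F : Set (Path K 𝓧)} {c : ℝ≥0∞}
    (hF : ∀ᵐ ω ∂(M.law ν 𝒜), ω ∈ F →
      c ≤ ∏ i ∈ (Finset.Ico s n).filter (fun i => A i ω = a), g (ω i a)) :
    c * M.law ν 𝒜 (E ∩ F) ≤ M.law ν 𝒜 E := by
  have hE' := hA.history_le _ E hE
  refine le_trans ?_ (setLIntegral_prod_selected_le hA hs hg hint hE hn)
  have hmeas : Measurable fun ω : Path K 𝓧 =>
      ∏ i ∈ (Finset.Ico s n).filter (fun i => A i ω = a), g (ω i a) := by
    simp_rw [Finset.prod_filter]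
    refine Finset.measurable_fun_prod _ fun i hi => ?_
    rw [Finset.mem_Ico] at hi
    exact (hA.measurable_ite (n := i) (by omega) le_rfl a hg measurable_const).mono
      (hA.history_le _) le_rfl
  refine le_trans ?_ (mul_meas_ge_le_lintegral₀ hmeas.aemeasurable c)
  rw [Measure.restrict_apply' hE', Set.inter_comm]
  gcongr 1
  refine measure_mono_ae ?_
  filter_upwards [hF] with ω hω h
  exact ⟨hω h.1, h.2⟩

lemma one_le_windowStart (W n : ℕ) : 1 ≤ windowStart W n := by simp [windowStart]

lemma windowStart_le {W n : ℕ} (hn : 1 ≤ n) : windowStart W n ≤ n := by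
  have := Nat.div_mul_le_self (n - 1) W
  unfold windowStart; omega

lemma exp_sum {ι : Type*} (s : Finset ι) (f : ι → EReal) :
    (∑ i ∈ s, f i).exp = ∏ i ∈ s, (f i).exp := by
  classical
  induction s using Finset.induction_on with
  | empty => simp
  | insert a s ha ih => rw [Finset.sum_insert ha, Finset.prod_insert ha, EReal.exp_add, ih]

/-- Upper deviations are phrased through powers of the density ratio, not real log-likelihood
ratios, because the action may be unaffected and its reward may then be `-∞`. -/
lemma measure_le_meanReward_le (hA : IsControlPolicy A) {W n : ℕ} (hn : 1 ≤ n) {a : Fin K}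
    {t q : ℝ} (ht : 0 ≤ t)
    (hint : ∀ i, windowStart W n ≤ i → ∫⁻ x, (M.f₁ a x / M.f₀ a x) ^ t ∂(M.obsLaw ν 𝒜 i a)
      ≤ ENNReal.ofReal (Real.exp (t * q)))
    {E : Set (Path K 𝓧)} (hE : MeasurableSet[history A (windowStart W n - 1)] E)
    {k : ℕ} (hk : 1 ≤ k) (y : ℝ) :
    M.law ν 𝒜 (E ∩ {ω | pulls A W a n ω = k ∧ (y : EReal) ≤ M.meanReward A W a n ω})
      ≤ ENNReal.ofReal (Real.exp (-(t * k * (y - q)))) * M.law ν 𝒜 E := by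
  set g : 𝓧 → ℝ≥0∞ := fun x =>
    (M.f₁ a x / M.f₀ a x) ^ t * ENNReal.ofReal (Real.exp (-(t * q))) with hgdef
  have hrm := (M.measurable_likelihoodRatio a).pow_const t
  have hg : Measurable g := hrm.mul_const _
  have hcancel : ENNReal.ofReal (Real.exp (t * q)) * ENNReal.ofReal (Real.exp (-(t * q))) = 1 := by
    rw [← ENNReal.ofReal_mul (Real.exp_pos _).le, ← Real.exp_add]; simp
  have hgint : ∀ i, windowStart W n ≤ i → ∫⁻ x, g x ∂(M.obsLaw ν 𝒜 i a) ≤ 1 := by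
    intro i hi
    rw [hgdef, lintegral_mul_const _ hrm, ← hcancel]
    gcongr
    exact hint i hi
  have key := mul_measure_inter_le hA (one_le_windowStart W n) hg hgint hE (windowStart_le hn)
    (F := {ω | pulls A W a n ω = k ∧ (y : EReal) ≤ M.meanReward A W a n ω})
    (c := ENNReal.ofReal (Real.exp (t * k * (y - q)))) (ae_of_all _ fun ω hω => by
      obtain ⟨hp, hy⟩ := hω
      rw [meanReward, hp, EReal.le_div_iff_mul_le (by exact_mod_cast hk) (EReal.coe_ne_top _),
        ← EReal.coe_mul] at hy
      have h1 := EReal.exp_monotone hy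
      rw [exp_sum, EReal.exp_coe] at h1
      simp_rw [exp_LLR] at h1
      have h2 := ENNReal.rpow_le_rpow h1 ht
      rw [← ENNReal.prod_rpow_of_nonneg ht, ENNReal.ofReal_rpow_of_pos (Real.exp_pos _),
        ← Real.exp_mul] at h2
      rw [hgdef, Finset.prod_mul_distrib, Finset.prod_const]
      rw [pulls] at hp
      rw [hp, ← ENNReal.ofReal_pow (Real.exp_pos _).le, ← Real.exp_nat_mul]
      refine le_trans (le_of_eq ?_) (mul_le_mul_left h2 _)
      rw [← ENNReal.ofReal_mul (Real.exp_pos _).le, ← Real.exp_add]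
      ring_nf)
  exact ENNReal.le_exp_neg_mul_of_exp_mul_le key

lemma Regular.ae_coe_toReal_LLR_obs (hM : M.Regular v) {ν : ℕ} {a : Fin K} (ha : a ∈ 𝒜) :
    ∀ᵐ ω ∂(M.law ν 𝒜), ∀ i, ν ≤ i →
      ((M.LLR a (ω i a)).toReal : EReal) = M.LLR a (ω i a) := by
  rw [ae_all_iff]
  intro i
  by_cases hi : ν ≤ i
  · have h := (M.measurePreserving_obs ν 𝒜 i a).quasiMeasurePreserving.tendsto_ae
    rw [obsLaw_of_mem hi ha] at h
    exact (h.eventually (hM.ae_coe_toReal_LLR a)).mono fun ω hω _ => hω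
  · exact ae_of_all _ fun ω h => absurd h hi

lemma coe_sum_toReal {ι : Type*} (s : Finset ι) (f : ι → EReal)
    (h : ∀ i ∈ s, ((f i).toReal : EReal) = f i) :
    ∑ i ∈ s, f i = ((∑ i ∈ s, (f i).toReal : ℝ) : EReal) := by
  classical
  induction s using Finset.induction_on with
  | empty => simp
  | insert a s ha ih =>
    rw [Finset.sum_insert ha, Finset.sum_insert ha, EReal.coe_add, h a (by simp),
      ih fun i hi => h i (by simp [hi])]

lemma Regular.measure_meanReward_le_le (hM : M.Regular v) (hA : IsControlPolicy A) {ν W n : ℕ}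
    (hn : 1 ≤ n) (hν : ν ≤ windowStart W n) {a : Fin K} (ha : a ∈ 𝒜) {t : ℝ} (ht : 0 ≤ t)
    {E : Set (Path K 𝓧)} (hE : MeasurableSet[history A (windowStart W n - 1)] E)
    {k : ℕ} (hk : 1 ≤ k) (y : ℝ) :
    M.law ν 𝒜 (E ∩ {ω | pulls A W a n ω = k ∧ M.meanReward A W a n ω ≤ y})
      ≤ ENNReal.ofReal (Real.exp (-(t * k * (M.KL a - y)) + k * (v * t ^ 2 / 2)))
        * M.law ν 𝒜 E := by
  set g : 𝓧 → ℝ≥0∞ := fun x => ENNReal.ofReal (Real.exp (-t * ((M.LLR a x).toReal - M.KL a)))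
    * ENNReal.ofReal (Real.exp (-(v * t ^ 2 / 2))) with hgdef
  have hrm : Measurable fun x =>
      ENNReal.ofReal (Real.exp (-t * ((M.LLR a x).toReal - M.KL a))) := by
    have := M.measurable_toReal_LLR a
    fun_prop
  have hg : Measurable g := hrm.mul_const _
  have hgint : ∀ i, windowStart W n ≤ i → ∫⁻ x, g x ∂(M.obsLaw ν 𝒜 i a) ≤ 1 := by
    intro i hi
    rw [obsLaw_of_mem (hν.trans hi) ha, hgdef, lintegral_mul_const _ hrm]
    refine (mul_le_mul_left (hM.lintegral_exp_le a (-t)) _).trans ?_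
    rw [← ENNReal.ofReal_mul (Real.exp_pos _).le, ← Real.exp_add]
    simp
  set x := -(t * k * (M.KL a - y)) + k * (v * t ^ 2 / 2) with hx
  have key := mul_measure_inter_le hA (one_le_windowStart W n) hg hgint hE (windowStart_le hn)
    (F := {ω | pulls A W a n ω = k ∧ M.meanReward A W a n ω ≤ y})
    (c := ENNReal.ofReal (Real.exp (-x))) (by
      filter_upwards [hM.ae_coe_toReal_LLR_obs (ν := ν) ha] with ω hω hωF
      obtain ⟨hp, hy⟩ := hωF
      have hsum := coe_sum_toReal
        ((Finset.Ico (windowStart W n) n).filter (fun i => A i ω = a))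
        (fun i => M.LLR a (ω i a)) (fun i hi => by
          rw [Finset.mem_filter, Finset.mem_Ico] at hi
          exact hω i (by omega))
      rw [meanReward, hp, hsum, EReal.div_le_iff_le_mul (by exact_mod_cast hk)
        (EReal.coe_ne_top _), ← EReal.coe_mul, EReal.coe_le_coe_iff] at hy
      rw [pulls] at hp
      rw [hgdef, Finset.prod_mul_distrib, Finset.prod_const, hp,
        ← ENNReal.ofReal_pow (Real.exp_pos _).le, ← Real.exp_nat_mul,
        ← ENNReal.ofReal_prod_of_nonneg (fun _ _ => (Real.exp_pos _).le), ← Real.exp_sum,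
        ← ENNReal.ofReal_mul (Real.exp_pos _).le, ← Real.exp_add]
      refine ENNReal.ofReal_le_ofReal (Real.exp_le_exp.2 ?_)
      rw [← Finset.mul_sum, Finset.sum_sub_distrib, Finset.sum_const, hp, nsmul_eq_mul, hx]
      have := mul_le_mul_of_nonneg_left hy ht
      linarith)
  simpa using ENNReal.le_exp_neg_mul_of_exp_mul_le key

end Concentration

end BanditQCD

/-- The counted indices have distinct numbers of predecessors satisfying `p`, all below `k`. It
bounds the selections made while an action still has few pulls. -/
lemma Finset.card_filter_card_filter_lt_le (p : ℕ → Prop) [DecidablePred p] (s n k : ℕ) :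
    ((Finset.Ico s n).filter fun i => p i ∧ ((Finset.Ico s i).filter p).card < k).card ≤ k := by
  suffices h : ((Finset.Ico s n).filter fun i => p i ∧ ((Finset.Ico s i).filter p).card < k).card
      ≤ min k ((Finset.Ico s n).filter p).card from h.trans (min_le_left _ _)
  induction n with
  | zero => simp
  | succ n ih =>
    rcases lt_or_ge n s with h | h
    · simp [Finset.Ico_eq_empty_of_le (show n + 1 ≤ s from h)]
    · rw [← Finset.insert_Ico_right_eq_Ico_add_one h, Finset.filter_insert, Finset.filter_insert]
      have hn : n ∉ Finset.Ico s n := by simp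
      split_ifs with h1 h2 h2
      · rw [Finset.card_insert_of_notMem (by simp), Finset.card_insert_of_notMem (by simp)]
        omega
      · exact absurd h1.1 h2
      · rw [Finset.card_insert_of_notMem (by simp : n ∉ (Finset.Ico s n).filter p)]
        omega
      · exact ih

namespace BanditQCD

lemma lt_windowStart_add {W n : ℕ} (hW : 1 ≤ W) : n < windowStart W n + W := by
  have := Nat.lt_div_mul_add (a := n - 1) hW
  unfold windowStart; omega

lemma windowStart_eq {W n j : ℕ} (h1 : j * W + 1 ≤ n) (h2 : n < j * W + 1 + W) :
    windowStart W n = j * W + 1 := by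
  have : (n - 1) / W = j := by
    refine Nat.div_eq_of_lt_le (by omega) ?_
    rw [Nat.add_mul]; omega
  rw [windowStart, this]

lemma pulls_le {K : ℕ} {𝓧 : Type*} {A : ℕ → Path K 𝓧 → Fin K} {W n : ℕ} (hW : 1 ≤ W)
    (a : Fin K) (ω : Path K 𝓧) : pulls A W a n ω ≤ W := by
  refine (Finset.card_filter_le _ _).trans ?_
  have := lt_windowStart_add (n := n) hW
  rw [Nat.card_Ico]; omega

/-! ### The UCB policy within one restart interval. -/

section UCB

variable {K : ℕ} {𝓧 : Type*} [MeasurableSpace 𝓧] {M : BanditQCD K 𝓧} {v : ℝ≥0}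
  {A : ℕ → Path K 𝓧 → Fin K} {ν W n : ℕ} {𝒜 : Finset (Fin K)}

/-- The number of pulls is random, so a union bound over its at most `W` values is taken; each costs
`W⁻²`. -/
lemma measure_inter_le_of_subset_iUnion {Ω : Type*} [MeasurableSpace Ω] (P : Measure Ω)
    (hW : 1 ≤ W) {E F : Set Ω} {G : ℕ → Set Ω} {k₀ : ℕ} (hk₀ : 1 ≤ k₀)
    (hF : F ⊆ ⋃ k ∈ Finset.Icc k₀ W, G k)
    (hG : ∀ k, k₀ ≤ k → P (E ∩ G k) ≤ ENNReal.ofReal (Real.exp (-(2 * Real.log W))) * P E) :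
    P (E ∩ F) ≤ ENNReal.ofReal (W : ℝ)⁻¹ * P E := by
  have hW' : (0 : ℝ) < W := by exact_mod_cast hW
  calc P (E ∩ F) ≤ P (⋃ k ∈ Finset.Icc k₀ W, E ∩ G k) := by
        refine measure_mono fun ω hω => ?_
        have := hF hω.2
        simp only [Set.mem_iUnion] at this ⊢
        obtain ⟨k, hk, hω'⟩ := this
        exact ⟨k, hk, hω.1, hω'⟩
    _ ≤ ∑ k ∈ Finset.Icc k₀ W, P (E ∩ G k) := measure_biUnion_finset_le _ _
    _ ≤ ∑ _k ∈ Finset.Icc k₀ W, ENNReal.ofReal (Real.exp (-(2 * Real.log W))) * P E :=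
        Finset.sum_le_sum fun k hk => hG k (Finset.mem_Icc.1 hk).1
    _ ≤ W * (ENNReal.ofReal (Real.exp (-(2 * Real.log W))) * P E) := by
        rw [Finset.sum_const, nsmul_eq_mul]
        gcongr
        rw [Nat.card_Icc]; omega
    _ = _ := by
        rw [← mul_assoc, ← ENNReal.ofReal_natCast W, ← ENNReal.ofReal_mul hW'.le]
        congr 2
        rw [Real.exp_neg, two_mul, Real.exp_add, Real.exp_log hW']
        field_simp

/-- For `v > 0` the optimal `t` balances the confidence bonus: the linear term is `-4L` and the
variance term `2L`. For `v = 0` the bonus vanishes and the slack `ε` supplies the deviation. -/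
lemma exists_chernoff_exponent (v : ℝ≥0) {L ε : ℝ} (hL : 0 ≤ L) (hε : 0 < ε) {k : ℕ}
    (hk : 1 ≤ k) :
    ∃ t : ℝ, 0 ≤ t ∧ -(t * k * (ε + Real.sqrt (4 * v * L / k))) + k * (v * t ^ 2 / 2)
      ≤ -(2 * L) := by
  have hk' : (1 : ℝ) ≤ k := by exact_mod_cast hk
  have hk0 : (0 : ℝ) < k := by linarith
  rcases eq_or_lt_of_le (zero_le : 0 ≤ v) with hv | hv
  · refine ⟨2 * L / ε, by positivity, ?_⟩
    have h1 : 2 * L / ε * k * ε = 2 * L * k := by field_simp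
    simp only [← hv]
    have : L * 1 ≤ L * k := by gcongr
    simp
    linarith
  · have hv' : (0 : ℝ) < v := by exact_mod_cast hv
    refine ⟨Real.sqrt (4 * L / (v * k)), Real.sqrt_nonneg _, ?_⟩
    have h1 : Real.sqrt (4 * L / (v * k)) * Real.sqrt (4 * v * L / k) = 4 * L / k := by
      rw [← Real.sqrt_mul (by positivity)]
      have : 4 * L / (v * k) * (4 * v * L / k) = (4 * L / k) ^ 2 := by field_simp
      rw [this, Real.sqrt_sq (by positivity)]
    have h2 : Real.sqrt (4 * L / (v * k)) ^ 2 = 4 * L / (v * k) := Real.sq_sqrt (by positivity)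
    have h3 : 0 ≤ Real.sqrt (4 * L / (v * k)) * k * ε := by positivity
    have h4 : Real.sqrt (4 * L / (v * k)) * k * Real.sqrt (4 * v * L / k) = 4 * L := by
      rw [mul_right_comm, h1]; field_simp
    rw [h2]
    have h5 : (k : ℝ) * (v * (4 * L / (v * k)) / 2) = 2 * L := by
      field_simp; ring
    rw [h5, mul_add]
    linarith

lemma Regular.measure_ucbIndex_lt_le (hM : M.Regular v) (hA : IsControlPolicy A) (hW : 1 ≤ W)
    (hn : 1 ≤ n) (hν : ν ≤ windowStart W n) {a : Fin K} (ha : a ∈ 𝒜) {ε : ℝ} (hε : 0 < ε)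
    {E : Set (Path K 𝓧)} (hE : MeasurableSet[history A (windowStart W n - 1)] E) :
    M.law ν 𝒜 (E ∩ {ω | M.ucbIndex v A W a n ω < ((M.KL a - ε : ℝ) : EReal)})
      ≤ ENNReal.ofReal (W : ℝ)⁻¹ * M.law ν 𝒜 E := by
  have hL : 0 ≤ Real.log W := Real.log_natCast_nonneg W
  refine measure_inter_le_of_subset_iUnion _ hW (k₀ := 1) le_rfl
    (G := fun k => {ω | pulls A W a n ω = k ∧ M.meanReward A W a n ω
      ≤ ((M.KL a - ε - Real.sqrt (4 * v * Real.log W / k) : ℝ) : EReal)}) ?_ ?_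
  · intro ω hω
    simp only [Set.mem_iUnion, Set.mem_ofPred_eq, Finset.mem_Icc] at hω ⊢
    unfold ucbIndex at hω
    split_ifs at hω with h0
    · simp at hω
    refine ⟨_, ⟨Nat.one_le_iff_ne_zero.2 h0, pulls_le hW a ω⟩, rfl, ?_⟩
    rw [EReal.coe_sub]
    exact (EReal.le_sub_iff_add_le (by simp) (by simp)).2 hω.le
  · intro k hk
    obtain ⟨t, ht, hle⟩ := exists_chernoff_exponent v hL hε hk
    refine (hM.measure_meanReward_le_le hA hn hν ha ht hE hk _).trans ?_
    gcongr
    refine le_trans (le_of_eq ?_) hle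
    ring

lemma measure_le_meanReward_of_le_pulls (hA : IsControlPolicy A) (hW : 1 ≤ W) (hn : 1 ≤ n)
    {a : Fin K} {t q y : ℝ} (ht : 0 ≤ t) (hqy : q ≤ y)
    (hint : ∀ i, windowStart W n ≤ i → ∫⁻ x, (M.f₁ a x / M.f₀ a x) ^ t ∂(M.obsLaw ν 𝒜 i a)
      ≤ ENNReal.ofReal (Real.exp (t * q)))
    {E : Set (Path K 𝓧)} (hE : MeasurableSet[history A (windowStart W n - 1)] E)
    {k₀ : ℕ} (hk₀ : 1 ≤ k₀) (hle : 2 * Real.log W ≤ t * k₀ * (y - q)) :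
    M.law ν 𝒜 (E ∩ {ω | k₀ ≤ pulls A W a n ω ∧ (y : EReal) ≤ M.meanReward A W a n ω})
      ≤ ENNReal.ofReal (W : ℝ)⁻¹ * M.law ν 𝒜 E := by
  refine measure_inter_le_of_subset_iUnion _ hW hk₀
    (G := fun k => {ω | pulls A W a n ω = k ∧ (y : EReal) ≤ M.meanReward A W a n ω}) ?_ ?_
  · intro ω hω
    simp only [Set.mem_iUnion, Set.mem_ofPred_eq, Finset.mem_Icc] at hω ⊢
    exact ⟨_, ⟨hω.1, pulls_le hW a ω⟩, rfl, hω.2⟩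
  · intro k hk
    refine (measure_le_meanReward_le hA hn ht hint hE (hk₀.trans hk) y).trans ?_
    have : (0 : ℝ) ≤ y - q := by linarith
    have hle' : 2 * Real.log W ≤ t * k * (y - q) := hle.trans (by gcongr)
    gcongr ENNReal.ofReal (Real.exp (-?_)) * _

/-- After `k₀` pulls the bonus of `a` is at most `ε`, so beating a non-pessimistic index of `a'`
forces the empirical mean of `a` itself to be large. -/
lemma IsUCBPolicy.selected_cases (hA : M.IsUCBPolicy v W A) (hn : 1 ≤ n) {a a' : Fin K}
    {D ε : ℝ} {k₀ : ℕ} (hk₀ : 1 ≤ k₀)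
    (hle : 4 * v * Real.log W ≤ ε ^ 2 * k₀) (hε : 0 < ε) {ω : Path K 𝓧} (hω : A n ω = a)
    (hpulls : k₀ ≤ pulls A W a n ω)
    (hidx : ((D - ε : ℝ) : EReal) ≤ M.ucbIndex v A W a' n ω) :
    ((D - 2 * ε : ℝ) : EReal) ≤ M.meanReward A W a n ω := by
  have h := hidx.trans (hA.argmax n hn ω a')
  rw [hω, ucbIndex, if_neg (by omega)] at h
  have hk' : (1 : ℝ) ≤ pulls A W a n ω := by exact_mod_cast hk₀.trans hpulls
  have hsqrt : Real.sqrt (4 * v * Real.log W / pulls A W a n ω) ≤ ε := by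
    rw [Real.sqrt_le_left hε.le, div_le_iff₀ (by linarith)]
    refine hle.trans ?_
    gcongr
  have h2 := EReal.sub_le_of_le_add h
  refine le_trans ?_ h2
  rw [← EReal.coe_sub, EReal.coe_le_coe_iff]
  linarith

/-- At most `k₀` selections occur while `a` has fewer than `k₀` pulls. A later one needs `a'`
underestimated or `a` overestimated, each of conditional probability at most `1 / W`, which over `W`
steps gives the extra `2`. -/
lemma IsUCBPolicy.sum_measure_selected_le (hM : M.Regular v) (hA : M.IsUCBPolicy v W A)
    (hW : 1 ≤ W) {j : ℕ} (hν : ν ≤ j * W + 1) {a a' : Fin K} (ha' : a' ∈ 𝒜) {ε t q : ℝ}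
    (hε : 0 < ε) (ht : 0 ≤ t) (hq : q ≤ M.KL a' - 2 * ε)
    (hint : ∀ i, ν ≤ i → ∫⁻ x, (M.f₁ a x / M.f₀ a x) ^ t ∂(M.obsLaw ν 𝒜 i a)
      ≤ ENNReal.ofReal (Real.exp (t * q)))
    {k₀ : ℕ} (hk₀ : 1 ≤ k₀) (hk₁ : 4 * v * Real.log W ≤ ε ^ 2 * k₀)
    (hk₂ : 2 * Real.log W ≤ t * k₀ * (M.KL a' - 2 * ε - q))
    {E : Set (Path K 𝓧)} (hE : MeasurableSet[history A (j * W)] E) :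
    ∑ n ∈ Finset.Ico (j * W + 1) (j * W + 1 + W), M.law ν 𝒜 (E ∩ {ω | A n ω = a})
      ≤ ((k₀ + 2 : ℕ) : ℝ≥0∞) * M.law ν 𝒜 E := by
  have hc := hA.isControlPolicy
  set P := M.law ν 𝒜
  have hE' := hc.history_le _ E hE
  have hstep : ∀ n ∈ Finset.Ico (j * W + 1) (j * W + 1 + W),
      P (E ∩ {ω | A n ω = a}) ≤ P (E ∩ {ω | A n ω = a ∧ pulls A W a n ω < k₀})
        + 2 * (ENNReal.ofReal (W : ℝ)⁻¹ * P E) := by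
    intro n hn
    rw [Finset.mem_Ico] at hn
    have hn1 : 1 ≤ n := by omega
    have hs := windowStart_eq hn.1 hn.2
    have hE'' : MeasurableSet[history A (windowStart W n - 1)] E := by rw [hs]; exact hE
    have hν' : ν ≤ windowStart W n := hs ▸ hν
    have hsub : E ∩ {ω | A n ω = a} ⊆ (E ∩ {ω | A n ω = a ∧ pulls A W a n ω < k₀}) ∪
        ((E ∩ {ω | M.ucbIndex v A W a' n ω < ((M.KL a' - ε : ℝ) : EReal)}) ∪
        (E ∩ {ω | k₀ ≤ pulls A W a n ω ∧
          ((M.KL a' - 2 * ε : ℝ) : EReal) ≤ M.meanReward A W a n ω})) := by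
      rintro ω ⟨hωE, hω⟩
      rcases lt_or_ge (pulls A W a n ω) k₀ with h | h
      · exact Or.inl ⟨hωE, hω, h⟩
      rcases lt_or_ge (M.ucbIndex v A W a' n ω) ((M.KL a' - ε : ℝ) : EReal) with h' | h'
      · exact Or.inr (Or.inl ⟨hωE, h'⟩)
      · exact Or.inr (Or.inr ⟨hωE, h, hA.selected_cases hn1 hk₀ hk₁ hε hω h h'⟩)
    refine (measure_mono hsub).trans ((measure_union_le _ _).trans ?_)
    gcongr
    refine (measure_union_le _ _).trans ?_
    rw [two_mul (ENNReal.ofReal _ * _)]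
    exact add_le_add (hM.measure_ucbIndex_lt_le hc hW hn1 hν' ha' hε hE'')
      (measure_le_meanReward_of_le_pulls hc hW hn1 ht hq
        (fun i hi => hint i (hν'.trans hi)) hE'' hk₀ hk₂)
  have hmeas : ∀ n ∈ Finset.Ico (j * W + 1) (j * W + 1 + W),
      MeasurableSet {ω | A n ω = a ∧ pulls A W a n ω < k₀} := by
    intro n hn
    rw [Finset.mem_Ico] at hn
    exact (hc.history_le _ _ (hc.measurableSet_action_eq (n := n) (by omega) (by omega) a)).inter
      (hc.history_le _ _ ((hc.measurable_pulls W a (by omega)) measurableSet_Iio))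
  have hfew : ∑ n ∈ Finset.Ico (j * W + 1) (j * W + 1 + W),
      P (E ∩ {ω | A n ω = a ∧ pulls A W a n ω < k₀}) ≤ k₀ * P E := by
    calc _ = ∫⁻ ω in E, ∑ n ∈ Finset.Ico (j * W + 1) (j * W + 1 + W),
          {ω | A n ω = a ∧ pulls A W a n ω < k₀}.indicator 1 ω ∂P := by
          rw [lintegral_finsetSum' _ fun n hn =>
            (measurable_one.indicator (hmeas n hn)).aemeasurable]
          refine Finset.sum_congr rfl fun n hn => ?_
          rw [lintegral_indicator_one (hmeas n hn), Measure.restrict_apply (hmeas n hn),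
            Set.inter_comm]
      _ ≤ ∫⁻ ω in E, (k₀ : ℝ≥0∞) ∂P := by
          refine lintegral_mono fun ω => ?_
          have h := Finset.card_filter_card_filter_lt_le (fun i => A i ω = a) (j * W + 1)
            (j * W + 1 + W) k₀
          rw [Finset.card_filter] at h
          have h' := (Nat.cast_le (α := ℝ≥0∞)).2 h
          rw [Nat.cast_sum] at h'
          refine le_trans (Finset.sum_le_sum fun n hn => ?_) h'
          rw [Finset.mem_Ico] at hn
          simp only [Set.indicator, Set.mem_ofPred_eq, pulls, windowStart_eq hn.1 hn.2]
          split_ifs <;> simp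
      _ = k₀ * P E := by rw [setLIntegral_const]
  have hW' : (0 : ℝ) < W := by exact_mod_cast hW
  have hone : (W : ℝ≥0∞) * ENNReal.ofReal (W : ℝ)⁻¹ = 1 := by
    rw [← ENNReal.ofReal_natCast W, ← ENNReal.ofReal_mul hW'.le, mul_inv_cancel₀ hW'.ne',
      ENNReal.ofReal_one]
  calc _ ≤ ∑ n ∈ Finset.Ico (j * W + 1) (j * W + 1 + W),
        (P (E ∩ {ω | A n ω = a ∧ pulls A W a n ω < k₀})
          + 2 * (ENNReal.ofReal (W : ℝ)⁻¹ * P E)) := Finset.sum_le_sum hstep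
    _ ≤ k₀ * P E + 2 * P E := by
        rw [Finset.sum_add_distrib, Finset.sum_const, Nat.card_Ico, nsmul_eq_mul,
          show j * W + 1 + W - (j * W + 1) = W by omega, mul_left_comm, ← mul_assoc (W : ℝ≥0∞),
          hone, one_mul]
        gcongr
    _ = _ := by push_cast; ring

/-- For an affected action, `t` is small enough that the sub-Gaussian correction uses at most half
of the gap to `D`. For an unaffected one, `t = 1` and `q = 0` express that the likelihood ratio has
mean at most one. -/
lemma Regular.exists_exponential_moment (hM : M.Regular v) {D : ℝ} (hD : 0 < D) {a : Fin K}
    (ha : a ∈ 𝒜 → M.KL a < D) :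
    ∃ t q : ℝ, 0 < t ∧ q < D ∧ ∀ ν i : ℕ, ν ≤ i →
      ∫⁻ x, (M.f₁ a x / M.f₀ a x) ^ t ∂(M.obsLaw ν 𝒜 i a)
        ≤ ENNReal.ofReal (Real.exp (t * q)) := by
  by_cases h : a ∈ 𝒜
  · have hlt := ha h
    have hv : (0 : ℝ) ≤ v := v.2
    refine ⟨(D - M.KL a) / (v + 1), M.KL a + v * ((D - M.KL a) / (v + 1)) / 2,
      div_pos (by linarith) (by linarith), ?_, fun ν i hi => ?_⟩
    · have : v * ((D - M.KL a) / (v + 1)) ≤ D - M.KL a := by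
        rw [mul_div_assoc', div_le_iff₀ (by linarith)]
        nlinarith
      linarith
    · rw [obsLaw_of_mem hi h]
      exact hM.lintegral_rpow_post_le a _
  · refine ⟨1, 0, one_pos, hD, fun ν i _ => ?_⟩
    rw [obsLaw_of_notMem h]
    simpa using M.lintegral_likelihoodRatio_pre_le a

/-- In each interval after the change, a UCB policy selects the best affected action at all but
`O(log W)` time steps in expectation, whatever has happened before the interval. -/
theorem Regular.exists_le_sum_measure_selected (hM : M.Regular v) {a' : Fin K} (ha' : a' ∈ 𝒜)
    (hmax : ∀ a ∈ 𝒜, a ≠ a' → M.KL a < M.KL a') :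
    ∃ C : ℝ, 0 ≤ C ∧ ∀ (W : ℕ) (A : ℕ → Path K 𝓧 → Fin K) (ν j : ℕ), 1 ≤ W →
      M.IsUCBPolicy v W A → ν ≤ j * W + 1 → ∀ E, MeasurableSet[history A (j * W)] E →
        (W - C * (Real.log W + 1)) * (M.law ν 𝒜).real E
          ≤ ∑ n ∈ Finset.Ico (j * W + 1) (j * W + 1 + W),
            (M.law ν 𝒜).real (E ∩ {ω | A n ω = a'}) := by
  have hD := hM.KL_pos a'
  have hmom : ∀ a, ∃ t q : ℝ, a ≠ a' → 0 < t ∧ q < M.KL a' ∧ ∀ ν i : ℕ, ν ≤ i →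
      ∫⁻ x, (M.f₁ a x / M.f₀ a x) ^ t ∂(M.obsLaw ν 𝒜 i a)
        ≤ ENNReal.ofReal (Real.exp (t * q)) := by
    intro a
    by_cases h : a = a'
    · exact ⟨0, 0, fun h' => absurd h h'⟩
    · obtain ⟨t, q, h'⟩ := hM.exists_exponential_moment hD (a := a) (𝒜 := 𝒜)
        fun ha => hmax a ha h
      exact ⟨t, q, fun _ => h'⟩
  choose t q htq using hmom
  obtain ⟨ε, hεq, hε⟩ : ∃ ε : ℝ, (∀ a, a ≠ a' → q a < M.KL a' - 2 * ε) ∧ 0 < ε := by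
    have h1 : ∀ᶠ ε : ℝ in 𝓝[>] 0, ∀ a, a ≠ a' → q a < M.KL a' - 2 * ε := by
      refine eventually_all.2 fun a => ?_
      by_cases h : a = a'
      · exact Eventually.of_forall fun _ h' => absurd h h'
      · have hc : Tendsto (fun ε : ℝ => M.KL a' - 2 * ε) (𝓝[>] 0) (𝓝 (M.KL a' - 2 * 0)) :=
          ((continuous_const.sub (continuous_const.mul continuous_id)).tendsto 0).mono_left
            nhdsWithin_le_nhds
        rw [mul_zero, sub_zero] at hc
        exact (hc.eventually_const_lt (htq a h).2.1).mono fun ε hε _ => hε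
    exact (h1.and self_mem_nhdsWithin).exists
  -- With `C * log W` pulls, both the bonus is below `ε` and the Chernoff bound reaches `W⁻²`, for
  -- all other actions at once.
  obtain ⟨C, hC, hCv, hC0⟩ : ∃ C : ℝ, (∀ a, a ≠ a' → 2 ≤ t a * C * (M.KL a' - 2 * ε - q a)) ∧
      4 * v ≤ ε ^ 2 * C ∧ 0 ≤ C := by
    have h1 : ∀ᶠ C : ℝ in atTop, ∀ a, a ≠ a' → 2 ≤ t a * C * (M.KL a' - 2 * ε - q a) := by
      refine eventually_all.2 fun a => ?_
      by_cases h : a = a'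
      · exact Eventually.of_forall fun _ h' => absurd h h'
      · have hc := (tendsto_id.const_mul_atTop (htq a h).1).atTop_mul_const
          (sub_pos.2 (hεq a h))
        exact (hc.eventually_ge_atTop 2).mono fun C hC _ => hC
    have h2 : ∀ᶠ C : ℝ in atTop, 4 * v ≤ ε ^ 2 * C :=
      (tendsto_id.const_mul_atTop (by positivity)).eventually_ge_atTop _
    exact (h1.and (h2.and (eventually_ge_atTop 0))).exists
  -- Each competing action costs `k₀ + 2`, which rounding up bounds by `C * log W + 4`; there are at
  -- most `K` of them.
  refine ⟨K * (C + 4), by positivity, fun W A ν j hW hA hν E hE => ?_⟩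
  have hc := hA.isControlPolicy
  have hL : 0 ≤ Real.log W := Real.log_natCast_nonneg W
  set P := M.law ν 𝒜
  set k₀ := ⌈C * Real.log W⌉₊ + 1 with hk₀def
  have hk₀ : C * Real.log W ≤ k₀ := by
    rw [hk₀def]; push_cast
    linarith [Nat.le_ceil (C * Real.log W)]
  have hk₀' : ((k₀ + 2 : ℕ) : ℝ) ≤ (C + 4) * (Real.log W + 1) := by
    rw [hk₀def]; push_cast
    nlinarith [Nat.ceil_lt_add_one (mul_nonneg hC0 hL)]
  have hbad : ∀ a, a ≠ a' → ∑ n ∈ Finset.Ico (j * W + 1) (j * W + 1 + W),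
      P.real (E ∩ {ω | A n ω = a}) ≤ (C + 4) * (Real.log W + 1) * P.real E := by
    intro a ha
    have hpos := sub_pos.2 (hεq a ha)
    have h := hA.sum_measure_selected_le hM hW hν ha' hε (htq a ha).1.le (hεq a ha).le
      ((htq a ha).2.2 ν) (k₀ := k₀) (by omega)
      (by nlinarith [mul_le_mul_of_nonneg_right hCv hL,
        mul_le_mul_of_nonneg_left hk₀ (sq_nonneg ε)])
      (by
        calc 2 * Real.log W ≤ t a * C * (M.KL a' - 2 * ε - q a) * Real.log W := by
              gcongr; exact hC a ha
          _ = t a * (C * Real.log W) * (M.KL a' - 2 * ε - q a) := by ring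
          _ ≤ _ := by
              have := (htq a ha).1
              gcongr) hE
    have h' := ENNReal.toReal_mono (by finiteness) h
    rw [ENNReal.toReal_sum (fun n _ => by finiteness), ENNReal.toReal_mul,
      ENNReal.toReal_natCast] at h'
    exact h'.trans (mul_le_mul_of_nonneg_right hk₀' measureReal_nonneg)
  have htotal : ∀ n ∈ Finset.Ico (j * W + 1) (j * W + 1 + W),
      P.real E = ∑ a, P.real (E ∩ {ω | A n ω = a}) := by
    intro n hn
    rw [Finset.mem_Ico] at hn
    have hm : ∀ a, MeasurableSet {ω | A n ω = a} := fun a =>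
      hc.history_le _ _ (hc.measurableSet_action_eq (n := n) (by omega) (by omega) a)
    rw [← measureReal_biUnion_finset]
    · congr 1; ext ω; simp
    · intro a _ b _ hab
      exact Set.disjoint_left.2 fun ω h1 h2 => hab (h1.2.symm.trans h2.2)
    · exact fun a _ => (hc.history_le _ _ hE).inter (hm a)
  have hsum : W * P.real E = ∑ a, ∑ n ∈ Finset.Ico (j * W + 1) (j * W + 1 + W),
      P.real (E ∩ {ω | A n ω = a}) := by
    rw [Finset.sum_comm, ← Finset.sum_congr rfl htotal, Finset.sum_const, Nat.card_Ico,
      nsmul_eq_mul]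
    congr 2; omega
  rw [← Finset.add_sum_erase _ _ (Finset.mem_univ a')] at hsum
  have hrest : ∑ a ∈ Finset.univ.erase a', ∑ n ∈ Finset.Ico (j * W + 1) (j * W + 1 + W),
      P.real (E ∩ {ω | A n ω = a}) ≤ K * ((C + 4) * (Real.log W + 1) * P.real E) := by
    refine (Finset.sum_le_card_nsmul _ _ _ fun a ha => hbad a (Finset.ne_of_mem_erase ha)).trans ?_
    rw [nsmul_eq_mul]
    gcongr
    exact (Finset.card_le_univ _).trans_eq (Fintype.card_fin K)
  linarith

end UCB

/-! ### Detection delay by counting the intervals survived. -/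

section Delay

variable {K : ℕ} {𝓧 : Type*} [MeasurableSpace 𝓧] {M : BanditQCD K 𝓧} {v : ℝ≥0}
  {A : ℕ → Path K 𝓧 → Fin K} {W : ℕ} {𝒜 : Finset (Fin K)}

lemma worstCaseDelay_le (hA : IsControlPolicy A) {T : Path K 𝓧 → ℕ∞} {c : ℝ≥0∞}
    (h : ∀ ν : ℕ, 1 ≤ ν → ∀ H, MeasurableSet[history A (ν - 1)] H →
      ∫⁻ ω in H, ((T ω + 1 - (ν : ℕ∞) : ℕ∞) : ℝ≥0∞) ∂(M.law ν 𝒜) ≤ c * M.law ν 𝒜 H) :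
    M.worstCaseDelay 𝒜 A T ≤ c := by
  refine iSup₂_le fun ν hν => essSup_le_of_ae_le c ?_
  have hm := hA.history_le (ν - 1)
  refine ae_le_of_ae_le_trim (hm := hm) ?_
  refine ae_le_of_forall_setLIntegral_le_of_sigmaFinite (μ := (M.law ν 𝒜).trim hm)
    (measurable_condLExp _ _ _) fun H hH _ => ?_
  rw [setLIntegral_condLExp_trim hm _ _ hH, setLIntegral_const, trim_measurableSet_eq hm hH]
  exact h ν hν H hH

/-- The first `W` pays for the interval containing the change, which ends at `m`; each later
interval entered without alarm pays another `W`. -/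
lemma toENNReal_delay_le {m ν : ℕ} (hW : 1 ≤ W) (hm : m + 1 ≤ ν + W) (t : ℕ∞) :
    ((t + 1 - (ν : ℕ∞) : ℕ∞) : ℝ≥0∞)
      ≤ W + W * ∑' j : ℕ, if ((m + j * W : ℕ) : ℕ∞) < t then (1 : ℝ≥0∞) else 0 := by
  induction t using ENat.recTopCoe with
  | top =>
    have hW' : (W : ℝ≥0∞) ≠ 0 := by exact_mod_cast (by omega : W ≠ 0)
    have : ∀ j : ℕ, ((m + j * W : ℕ) : ℕ∞) < ⊤ := fun j => ENat.natCast_lt_top _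
    simp only [this, if_true, ENNReal.tsum_const_eq_top_of_ne_zero one_ne_zero,
      ENNReal.mul_top hW', add_top]
    exact le_top
  | coe t =>
    have hcount : ∀ J : ℕ, min t (m + J * W)
        ≤ m + W * ((Finset.range J).filter fun j => m + j * W < t).card := by
      intro J
      induction J with
      | zero => simp
      | succ J ih =>
        rw [Finset.range_add_one, Finset.filter_insert, Nat.add_mul]
        split_ifs with h
        · rw [Finset.card_insert_of_notMem (by simp), Nat.mul_add]
          omega
        · omega
    have h1 := hcount t
    rw [min_eq_left (by nlinarith)] at h1
    have h2 : (((Finset.range t).filter fun j => m + j * W < t).card : ℝ≥0∞)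
        ≤ ∑' j : ℕ, if ((m + j * W : ℕ) : ℕ∞) < (t : ℕ∞) then (1 : ℝ≥0∞) else 0 := by
      refine le_trans (le_of_eq ?_) (ENNReal.sum_le_tsum (Finset.range t))
      rw [Finset.card_filter, Nat.cast_sum]
      refine Finset.sum_congr rfl fun j _ => ?_
      by_cases h : m + j * W < t
      · rw [if_pos h, if_pos (by exact_mod_cast h), Nat.cast_one]
      · rw [if_neg h, if_neg (by exact_mod_cast h), Nat.cast_zero]
    have h3 : t + 1 - ν ≤ W + W * ((Finset.range t).filter fun j => m + j * W < t).card := by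
      omega
    calc (((t : ℕ∞) + 1 - (ν : ℕ∞) : ℕ∞) : ℝ≥0∞) = ((t + 1 - ν : ℕ) : ℝ≥0∞) := by
          rw [← Nat.cast_one, ← Nat.cast_add, ← ENat.natCast_sub, ENat.toENNReal_coe]
      _ ≤ ((W + W * ((Finset.range t).filter fun j => m + j * W < t).card : ℕ) : ℝ≥0∞) := by
          exact_mod_cast h3
      _ ≤ _ := by
          rw [Nat.cast_add, Nat.cast_mul]
          gcongr

/-- Reflection at zero only raises the statistic, so its state at time `m`, however low, does no
harm. -/
lemma coe_sum_le_max_cusum {a : Fin K} {ω : Path K 𝓧} {m n : ℕ} (hmn : m ≤ n)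
    (hω : ∀ i, m < i → ((M.LLR a (ω i a)).toReal : EReal) = M.LLR a (ω i a)) :
    ((∑ i ∈ Finset.Ico (m + 1) (n + 1), if A i ω = a then (M.LLR a (ω i a)).toReal else 0 : ℝ) :
      EReal) ≤ max (M.cusum A a n ω) 0 := by
  induction n, hmn using Nat.le_induction with
  | base => simp
  | succ n hn ih =>
    rw [Finset.sum_Ico_succ_top (by omega), cusum]
    split_ifs with h
    · rw [EReal.coe_add, hω (n + 1) (by omega)]
      exact le_max_of_le_left (add_le_add_left ih _)
    · rwa [add_zero]

/-- The sum of the truncated rewards of action `a` during the `W` time steps after `m`. -/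
noncomputable def truncatedReward (M : BanditQCD K 𝓧) (A : ℕ → Path K 𝓧 → Fin K) (W : ℕ)
    (a : Fin K) (B : ℝ) (m : ℕ) (ω : Path K 𝓧) : ℝ :=
  ∑ i ∈ Finset.Ico (m + 1) (m + 1 + W),
    if A i ω = a then min (M.LLR a (ω i a)).toReal B else 0

lemma sum_truncatedReward (a : Fin K) (B : ℝ) (m J : ℕ) (ω : Path K 𝓧) :
    ∑ j ∈ Finset.range J, M.truncatedReward A W a B (m + j * W) ω
      = ∑ i ∈ Finset.Ico (m + 1) (m + J * W + 1),
        if A i ω = a then min (M.LLR a (ω i a)).toReal B else 0 := by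
  induction J with
  | zero => simp
  | succ J ih =>
    rw [Finset.sum_range_succ, ih, truncatedReward,
      Finset.sum_Ico_consecutive _ (by omega) (by omega)]
    congr 2
    ring

lemma truncatedReward_le {B : ℝ} (hB : 0 ≤ B) (a : Fin K) (m : ℕ) (ω : Path K 𝓧) :
    M.truncatedReward A W a B m ω ≤ B * W := by
  refine (Finset.sum_le_card_nsmul _ _ B fun i _ => ?_).trans_eq ?_
  · split_ifs
    · exact min_le_right _ _
    · exact hB
  · rw [Nat.card_Ico, nsmul_eq_mul, mul_comm]; congr 2; omega

/-- Before the last surviving interval the rewards sum to at most `b`, as no alarm has been raised;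
truncation limits that last interval to `B * W`. -/
lemma sum_truncatedReward_before_alarm_le {B b : ℝ} (hB : 0 ≤ B) (hb : 0 ≤ b) {a : Fin K}
    {ω : Path K 𝓧} {m : ℕ}
    (hω : ∀ i, m < i → ((M.LLR a (ω i a)).toReal : EReal) = M.LLR a (ω i a)) (J : ℕ) :
    ∑ j ∈ Finset.range J, {ω | ((m + j * W : ℕ) : ℕ∞) < M.alarm A b ω}.indicator
      (M.truncatedReward A W a B (m + j * W)) ω ≤ b + B * W := by
  induction J with
  | zero => simp; positivity
  | succ J ih =>
    by_cases hJ : ((m + J * W : ℕ) : ℕ∞) < M.alarm A b ω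
    · have hall : ∀ j ∈ Finset.range (J + 1),
          {ω | ((m + j * W : ℕ) : ℕ∞) < M.alarm A b ω}.indicator
            (M.truncatedReward A W a B (m + j * W)) ω
          = M.truncatedReward A W a B (m + j * W) ω := by
        intro j hj
        have hle : j * W ≤ J * W := Nat.mul_le_mul_right _ (by simpa [Nat.lt_succ_iff] using hj)
        have hmem : ω ∈ {ω | ((m + j * W : ℕ) : ℕ∞) < M.alarm A b ω} :=
          lt_of_le_of_lt (by exact_mod_cast (by omega : m + j * W ≤ m + J * W)) hJ
        exact Set.indicator_of_mem hmem _
      rw [Finset.sum_congr rfl hall, Finset.sum_range_succ, sum_truncatedReward]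
      refine add_le_add ?_ (truncatedReward_le hB a _ ω)
      have h1 : ∑ i ∈ Finset.Ico (m + 1) (m + J * W + 1),
            (if A i ω = a then min (M.LLR a (ω i a)).toReal B else 0)
          ≤ ∑ i ∈ Finset.Ico (m + 1) (m + J * W + 1),
            if A i ω = a then (M.LLR a (ω i a)).toReal else 0 := by
        refine Finset.sum_le_sum fun i _ => ?_
        split_ifs
        · exact min_le_left _ _
        · exact le_rfl
      refine h1.trans ?_
      have h2 := coe_sum_le_max_cusum (A := A) (n := m + J * W) (by omega) hω
      have h3 : max (M.cusum A a (m + J * W) ω) 0 ≤ b := by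
        refine max_le ?_ (by exact_mod_cast hb)
        -- The alarm inspects times `n ≥ 1` only, so time zero is treated by the initial value.
        rcases Nat.eq_zero_or_pos (m + J * W) with h0 | h0
        · rw [h0, cusum]; exact_mod_cast hb
        · exact (M.lt_alarm_iff.1 hJ _ h0 le_rfl a).le
      exact_mod_cast h2.trans h3
    · have hJ' : ω ∉ {ω | ((m + J * W : ℕ) : ℕ∞) < M.alarm A b ω} := hJ
      rw [Finset.sum_range_succ, Set.indicator_of_notMem hJ', add_zero]
      exact ih

lemma Regular.exists_lt_integral_min (hM : M.Regular v) (a : Fin K) {y : ℝ} (hy : y < M.KL a) :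
    ∃ B : ℝ, 0 ≤ B ∧ y < ∫ x, min (M.LLR a x).toReal B ∂(M.post a) := by
  have hmeas := M.measurable_toReal_LLR a
  have h : Tendsto (fun n : ℕ => ∫ x, min (M.LLR a x).toReal n ∂(M.post a)) atTop
      (𝓝 (M.KL a)) := by
    refine tendsto_integral_of_dominated_convergence (fun x => |(M.LLR a x).toReal|)
      (fun n => (hmeas.min measurable_const).aestronglyMeasurable) (hM.integrable_LLR a).abs
      (fun n => ae_of_all _ fun x => ?_) (ae_of_all _ fun x => ?_)
    · rw [Real.norm_eq_abs]
      rcases le_total (M.LLR a x).toReal n with h | h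
      · rw [min_eq_left h]
      · rw [min_eq_right h, abs_of_nonneg (by positivity)]
        exact h.trans (le_abs_self _)
    · refine tendsto_const_nhds.congr' ?_
      filter_upwards [eventually_ge_atTop ⌈(M.LLR a x).toReal⌉₊] with n hn
      exact (min_eq_left ((Nat.le_ceil _).trans (by exact_mod_cast hn))).symm
  obtain ⟨n, hn⟩ := (h.eventually_const_lt hy).exists
  exact ⟨n, by positivity, hn⟩

lemma Regular.integrable_min_LLR (hM : M.Regular v) (a : Fin K) (B : ℝ) :
    Integrable (fun x => min (M.LLR a x).toReal B) (M.post a) :=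
  (hM.integrable_LLR a).inf (integrable_const B)

lemma Regular.integrable_truncatedReward (hM : M.Regular v) (hA : IsControlPolicy A) {ν m : ℕ}
    (hν : ν ≤ m + 1) {a : Fin K} (ha : a ∈ 𝒜) (B : ℝ) :
    Integrable (M.truncatedReward A W a B m) (M.law ν 𝒜) := by
  refine integrable_finsetSum _ fun i hi => ?_
  rw [Finset.mem_Ico] at hi
  have h := (M.measurePreserving_obs ν 𝒜 i a).integrable_comp_of_integrable
    (g := fun x => min (M.LLR a x).toReal B)
    (by rw [obsLaw_of_mem (by omega) ha]; exact hM.integrable_min_LLR a B)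
  have hs : MeasurableSet {ω | A i ω = a} :=
    hA.history_le _ _ (hA.measurableSet_action_eq (n := i) (by omega) (by omega) a)
  refine (h.indicator hs).congr (ae_of_all _ fun ω => ?_)
  by_cases hω : A i ω = a <;> simp [hω]

lemma Regular.setIntegral_truncatedReward (hM : M.Regular v) (hA : IsControlPolicy A) {ν m : ℕ}
    (hν : ν ≤ m + 1) {a : Fin K} (ha : a ∈ 𝒜) (B : ℝ) {E : Set (Path K 𝓧)}
    (hE : MeasurableSet[history A m] E) :
    ∫ ω in E, M.truncatedReward A W a B m ω ∂(M.law ν 𝒜)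
      = (∑ i ∈ Finset.Ico (m + 1) (m + 1 + W), (M.law ν 𝒜).real (E ∩ {ω | A i ω = a}))
        * ∫ x, min (M.LLR a x).toReal B ∂(M.post a) := by
  have hs : ∀ i, m + 1 ≤ i → MeasurableSet {ω | A i ω = a} := fun i hi =>
    hA.history_le _ _ (hA.measurableSet_action_eq (n := i) (by omega) (by omega) a)
  unfold truncatedReward
  rw [integral_finsetSum, Finset.sum_mul]
  · refine Finset.sum_congr rfl fun i hi => ?_
    rw [Finset.mem_Ico] at hi
    have hEi : MeasurableSet[history A (i - 1)] (E ∩ {ω | A i ω = a}) :=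
      (history_mono A (by omega) _ hE).inter (hA.measurableSet_action_eq (by omega) (by omega) a)
    have h := M.setIntegral_obs (ν := ν) (𝒜 := 𝒜) hA (n := i) (by omega) a hEi
      ((M.measurable_toReal_LLR a).min (measurable_const (a := B)))
    rw [obsLaw_of_mem (by omega) ha] at h
    rw [← h, ← setIntegral_indicator (hs i hi.1)]
    refine integral_congr_ae (ae_of_all _ fun ω => ?_)
    by_cases hω : A i ω = a <;> simp [hω]
  · intro i hi
    rw [Finset.mem_Ico] at hi
    have h := (M.measurePreserving_obs ν 𝒜 i a).integrable_comp_of_integrable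
      (g := fun x => min (M.LLR a x).toReal B)
      (by rw [obsLaw_of_mem (by omega) ha]; exact hM.integrable_min_LLR a B)
    refine (h.indicator (hs i hi.1)).integrableOn.congr (ae_of_all _ fun ω => ?_)
    by_cases hω : A i ω = a <;> simp [hω]

/-- Wald's argument: surviving up to the start of an interval is a past event, so on it the interval
yields expected truncated reward at least `y`, while the pathwise total is at most `b + B * W`. -/
lemma Regular.sum_measureReal_lt_alarm_le (hM : M.Regular v) (hA : IsControlPolicy A)
    {ν m : ℕ} (hν : ν ≤ m + 1) {a : Fin K} (ha : a ∈ 𝒜) {B b y : ℝ} (hB : 0 ≤ B) (hb : 0 ≤ b)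
    (hpos : 0 ≤ ∫ x, min (M.LLR a x).toReal B ∂(M.post a)) {u : ℝ}
    (hy : y ≤ u * ∫ x, min (M.LLR a x).toReal B ∂(M.post a))
    (hu : ∀ j E, MeasurableSet[history A (m + j * W)] E → u * (M.law ν 𝒜).real E
      ≤ ∑ n ∈ Finset.Ico (m + j * W + 1) (m + j * W + 1 + W),
        (M.law ν 𝒜).real (E ∩ {ω | A n ω = a}))
    {H : Set (Path K 𝓧)} (hH : MeasurableSet[history A m] H) (J : ℕ) :
    y * ∑ j ∈ Finset.range J,
        (M.law ν 𝒜).real (H ∩ {ω | ((m + j * W : ℕ) : ℕ∞) < M.alarm A b ω})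
      ≤ (b + B * W) * (M.law ν 𝒜).real H := by
  set P := M.law ν 𝒜
  have hH' := hA.history_le _ _ hH
  have hG : ∀ j, MeasurableSet[history A (m + j * W)]
      {ω | ((m + j * W : ℕ) : ℕ∞) < M.alarm A b ω} := fun j => M.measurableSet_lt_alarm hA b _
  have hG' := fun j => hA.history_le _ _ (hG j)
  have hint : ∀ j, Integrable ({ω | ((m + j * W : ℕ) : ℕ∞) < M.alarm A b ω}.indicator
      (M.truncatedReward A W a B (m + j * W))) P := fun j =>
    (hM.integrable_truncatedReward hA (by omega) ha B).indicator (hG' j)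
  calc _ = ∑ j ∈ Finset.range J,
        y * P.real (H ∩ {ω | ((m + j * W : ℕ) : ℕ∞) < M.alarm A b ω}) := Finset.mul_sum _ _ _
    _ ≤ ∑ j ∈ Finset.range J, ∫ ω in H, {ω | ((m + j * W : ℕ) : ℕ∞) < M.alarm A b ω}.indicator
          (M.truncatedReward A W a B (m + j * W)) ω ∂P := by
        refine Finset.sum_le_sum fun j _ => ?_
        have hHG : MeasurableSet[history A (m + j * W)]
            (H ∩ {ω | ((m + j * W : ℕ) : ℕ∞) < M.alarm A b ω}) :=
          (history_mono A (by omega) _ hH).inter (hG j)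
        rw [setIntegral_indicator (hG' j),
          hM.setIntegral_truncatedReward hA (by omega) ha B hHG]
        calc _ ≤ (u * ∫ x, min (M.LLR a x).toReal B ∂(M.post a))
              * P.real (H ∩ {ω | ((m + j * W : ℕ) : ℕ∞) < M.alarm A b ω}) := by gcongr
          _ = (u * P.real (H ∩ {ω | ((m + j * W : ℕ) : ℕ∞) < M.alarm A b ω}))
              * ∫ x, min (M.LLR a x).toReal B ∂(M.post a) := by ring
          _ ≤ _ := mul_le_mul_of_nonneg_right (hu j _ hHG) hpos
    _ = ∫ ω in H, ∑ j ∈ Finset.range J,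
          {ω | ((m + j * W : ℕ) : ℕ∞) < M.alarm A b ω}.indicator
          (M.truncatedReward A W a B (m + j * W)) ω ∂P :=
        (integral_finsetSum _ fun j _ => (hint j).integrableOn).symm
    _ ≤ ∫ _ω in H, (b + B * W) ∂P := by
        refine setIntegral_mono_ae (integrable_finsetSum _ fun j _ => hint j).integrableOn
          (integrable_const _).integrableOn ?_
        filter_upwards [hM.ae_coe_toReal_LLR_obs (ν := ν) ha] with ω hω
        exact sum_truncatedReward_before_alarm_le hB hb (fun i hi => hω i (by omega)) J
    _ = _ := by rw [setIntegral_const, smul_eq_mul, mul_comm]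

theorem Regular.worstCaseDelay_alarm_le (hM : M.Regular v) (hA : IsControlPolicy A) (hW : 1 ≤ W)
    {a : Fin K} (ha : a ∈ 𝒜) {B b y : ℝ} (hB : 0 ≤ B) (hb : 0 ≤ b) (hy₀ : 0 < y)
    (hpos : 0 ≤ ∫ x, min (M.LLR a x).toReal B ∂(M.post a)) {u : ℝ}
    (hy : W * y ≤ u * ∫ x, min (M.LLR a x).toReal B ∂(M.post a))
    (hu : ∀ ν j : ℕ, ν ≤ j * W + 1 → ∀ E, MeasurableSet[history A (j * W)] E →
      u * (M.law ν 𝒜).real E ≤ ∑ n ∈ Finset.Ico (j * W + 1) (j * W + 1 + W),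
        (M.law ν 𝒜).real (E ∩ {ω | A n ω = a})) :
    M.worstCaseDelay 𝒜 A (M.alarm A b) ≤ ENNReal.ofReal (W + (b + B * W) / y) := by
  have hW' : (0 : ℝ) < W := by exact_mod_cast hW
  refine worstCaseDelay_le hA fun ν hν H hH => ?_
  set P := M.law ν 𝒜
  -- The interval containing `ν` is skipped, even if `ν` is its first step; `j₀` indexes the next
  -- one.
  set j₀ := (ν - 1) / W + 1 with hj₀
  have hlow : ν ≤ j₀ * W := by
    have := Nat.lt_div_mul_add (a := ν - 1) hW
    rw [hj₀, Nat.add_mul]; omega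
  have hupp : j₀ * W + 1 ≤ ν + W := by
    have := Nat.div_mul_le_self (ν - 1) W
    rw [hj₀, Nat.add_mul]; omega
  have hH' := hA.history_le _ _ hH
  have hHm : MeasurableSet[history A (j₀ * W)] H := history_mono A (by omega) _ hH
  have hG : ∀ j, MeasurableSet {ω | ((j₀ * W + j * W : ℕ) : ℕ∞) < M.alarm A b ω} := fun j =>
    hA.history_le _ _ (M.measurableSet_lt_alarm hA b _)
  have hsum : ∑' j : ℕ, P (H ∩ {ω | ((j₀ * W + j * W : ℕ) : ℕ∞) < M.alarm A b ω})
      ≤ ENNReal.ofReal ((b + B * W) / (W * y)) * P H := by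
    refine ENNReal.tsum_le_of_sum_range_le fun J => ?_
    have h := hM.sum_measureReal_lt_alarm_le hA (ν := ν) (m := j₀ * W) (by omega) ha hB hb hpos
      hy (fun j E hE => by
        rw [← Nat.add_mul] at hE ⊢
        exact hu ν _ (by rw [Nat.add_mul]; omega) E hE) hHm J
    rw [mul_comm, ← le_div_iff₀ (by positivity)] at h
    rw [← ofReal_measureReal (μ := P) (s := H), ← ENNReal.ofReal_mul (by positivity)]
    calc _ = ENNReal.ofReal (∑ j ∈ Finset.range J,
          P.real (H ∩ {ω | ((j₀ * W + j * W : ℕ) : ℕ∞) < M.alarm A b ω})) := by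
          rw [ENNReal.ofReal_sum_of_nonneg fun _ _ => measureReal_nonneg]
          exact Finset.sum_congr rfl fun j _ => (ofReal_measureReal).symm
      _ ≤ _ := by
          refine ENNReal.ofReal_le_ofReal (h.trans_eq ?_)
          ring
  calc _ ≤ ∫⁻ ω in H, (W + W * ∑' j : ℕ,
        if ((j₀ * W + j * W : ℕ) : ℕ∞) < M.alarm A b ω then (1 : ℝ≥0∞) else 0) ∂P :=
        lintegral_mono fun ω => toENNReal_delay_le hW hupp _
    _ = W * P H + W * ∑' j : ℕ, P (H ∩ {ω | ((j₀ * W + j * W : ℕ) : ℕ∞) < M.alarm A b ω}) := by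
        have hm : ∀ j : ℕ, Measurable fun ω =>
            if ((j₀ * W + j * W : ℕ) : ℕ∞) < M.alarm A b ω then (1 : ℝ≥0∞) else 0 := fun j =>
          Measurable.ite (hG j) measurable_const measurable_const
        rw [lintegral_add_left measurable_const, setLIntegral_const,
          lintegral_const_mul _ (Measurable.tsum hm),
          lintegral_tsum fun j => (hm j).aemeasurable]
        congr 3
        ext j
        rw [Set.inter_comm, ← Measure.restrict_apply (hG j), ← lintegral_indicator_one (hG j)]
        refine lintegral_congr fun ω => ?_
        simp only [Set.indicator, Set.mem_ofPred_eq, Pi.one_apply]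
    _ ≤ W * P H + W * (ENNReal.ofReal ((b + B * W) / (W * y)) * P H) := by gcongr
    _ = _ := by
        rw [← mul_assoc, ← add_mul, ← ENNReal.ofReal_natCast W, ← ENNReal.ofReal_mul hW'.le,
          ← ENNReal.ofReal_add hW'.le (by positivity)]
        congr 3
        field_simp

end Delay

/-! ### First-order asymptotics of the delay. -/

section Optimality

variable {K : ℕ} {𝓧 : Type*} [MeasurableSpace 𝓧] {M : BanditQCD K 𝓧} {v : ℝ≥0}

theorem Regular.eventually_worstCaseDelay_le (hM : M.Regular v) {𝒜 : Finset (Fin K)}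
    {a : Fin K} (ha : a ∈ 𝒜) (hmax : ∀ a' ∈ 𝒜, a' ≠ a → M.KL a' < M.KL a)
    {ι : Type*} {l : Filter ι} {b : ι → ℝ} {W : ι → ℕ} {A : ι → ℕ → Path K 𝓧 → Fin K}
    (hb : Tendsto b l atTop) (hW : Tendsto W l atTop)
    (hWb : (fun i => (W i : ℝ)) =o[l] b) (hA : ∀ i, M.IsUCBPolicy v (W i) (A i))
    {η : ℝ} (hη : 0 < η) :
    ∀ᶠ i in l, M.worstCaseDelay 𝒜 (A i) (M.alarm (A i) (b i))
      ≤ ENNReal.ofReal (b i / M.KL a * (1 + η)) := by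
  have hD := hM.KL_pos a
  -- The error `η` is split in half: this `y` makes `b / y` exceed `b / M.KL a` by the factor `1 + η
  -- / 2`, and `κ` below lets the terms linear in `W` use the rest.
  set y := M.KL a / (1 + η / 2) with hydef
  have hy : 0 < y := by positivity
  have hyD : y < M.KL a := div_lt_self hD (by linarith)
  obtain ⟨B, hB, hlt⟩ := hM.exists_lt_integral_min a hyD
  set μ := ∫ x, min (M.LLR a x).toReal B ∂(M.post a) with hμ
  have hμ0 : 0 < μ := hy.trans hlt
  obtain ⟨C, hC, hpulls⟩ := hM.exists_le_sum_measure_selected ha hmax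
  have hlog : ∀ᶠ w : ℕ in atTop, w * y ≤ (w - C * (Real.log w + 1)) * μ := by
    have h1 : (fun w : ℝ => C * (Real.log w + 1)) =o[atTop] fun w : ℝ => w :=
      (Real.isLittleO_log_id_atTop.add
        (Asymptotics.isLittleO_const_id_atTop (1 : ℝ))).const_mul_left C
    have h2 := (h1.def (c := (μ - y) / μ) (by
      have := sub_pos.2 hlt
      positivity)).natCast_atTop
    filter_upwards [h2] with w hw
    rw [Real.norm_eq_abs, Real.norm_eq_abs, Nat.abs_cast] at hw
    have h3 := (le_abs_self _).trans hw
    rw [div_mul_eq_mul_div, le_div_iff₀ hμ0] at h3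
    linarith
  set κ := η / (2 * M.KL a) / (1 + B / y) with hκ
  have hκ0 : 0 < κ := by positivity
  filter_upwards [hW.eventually hlog, hW.eventually_ge_atTop 1, hb.eventually_ge_atTop 0,
    hWb.def hκ0] with i hi hWi hbi hsmall
  refine (hM.worstCaseDelay_alarm_le (hA i).isControlPolicy hWi ha hB hbi hy hμ0.le hi
    fun ν j hν E hE => hpulls (W i) (A i) ν j hWi (hA i) hν E hE).trans ?_
  refine ENNReal.ofReal_le_ofReal ?_
  rw [Real.norm_eq_abs, Real.norm_eq_abs, Nat.abs_cast, abs_of_nonneg hbi] at hsmall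
  have h1 : (W i : ℝ) * (1 + B / y) ≤ η / (2 * M.KL a) * b i := by
    calc _ ≤ κ * b i * (1 + B / y) := by gcongr
      _ = _ := by rw [hκ]; field_simp
  have h2 : b i / y = b i / M.KL a * (1 + η / 2) := by rw [hydef]; field_simp
  calc (W i : ℝ) + (b i + B * W i) / y = W i * (1 + B / y) + b i / y := by ring
    _ ≤ η / (2 * M.KL a) * b i + b i / M.KL a * (1 + η / 2) := by rw [h2]; gcongr
    _ = _ := by field_simp; ring

/-- Trades a family of bounds, one for each `η`, for a single `1 + o(1)`: the relative excess of `J`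
over `c`, cut off at zero, serves as the error term. -/
lemma exists_tendsto_zero_le_ofReal {ι : Type*} {l : Filter ι} {J : ι → ℝ≥0∞} {c : ι → ℝ}
    (hc : ∀ᶠ i in l, 0 < c i)
    (h : ∀ η : ℝ, 0 < η → ∀ᶠ i in l, J i ≤ ENNReal.ofReal (c i * (1 + η))) :
    ∃ r : ι → ℝ, Tendsto r l (𝓝 0) ∧ ∀ᶠ i in l, J i ≤ ENNReal.ofReal (c i * (1 + r i)) := by
  refine ⟨fun i => max ((J i).toReal / c i - 1) 0, ?_, ?_⟩
  · rw [Metric.tendsto_nhds]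
    intro ε hε
    filter_upwards [h (ε / 2) (by positivity), hc] with i hi hci
    have h1 : (J i).toReal ≤ c i * (1 + ε / 2) := ENNReal.toReal_le_of_le_ofReal (by positivity) hi
    have h2 : (J i).toReal / c i ≤ 1 + ε / 2 := by rwa [div_le_iff₀' hci]
    rw [Real.dist_eq, sub_zero, abs_of_nonneg (le_max_right _ _)]
    exact max_lt (by linarith) hε
  · filter_upwards [h 1 one_pos, hc] with i hi hci
    have hJ : J i ≠ ⊤ := ne_top_of_le_ne_top ENNReal.ofReal_ne_top hi
    refine (ENNReal.ofReal_toReal hJ).symm.le.trans (ENNReal.ofReal_le_ofReal ?_)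
    rw [← div_le_iff₀' hci]
    linarith [le_max_left ((J i).toReal / c i - 1) 0]

end Optimality

end BanditQCD
theorem theorem2 {K : ℕ} {𝓧 : Type*} [MeasurableSpace 𝓧] (M : BanditQCD K 𝓧) (v : ℝ≥0)
    (hM : M.Regular v) :
    (∀ (W : ℕ) (A : ℕ → BanditQCD.Path K 𝓧 → Fin K) (γ : ℝ),
      1 ≤ W → M.IsUCBPolicy v W A → 0 < γ →
        ENNReal.ofReal γ ≤ M.meanTimeToFalseAlarm (M.alarm A (Real.log γ))) ∧
    (∀ (𝒜 : Finset (Fin K)) (h𝒜 : 𝒜.Nonempty),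
      (∃! a, a ∈ 𝒜 ∧ M.KL a = M.maxKL 𝒜 h𝒜) →
      ∀ {ι : Type*} (l : Filter ι) (γ : ι → ℝ) (W : ι → ℕ)
        (A : ι → ℕ → BanditQCD.Path K 𝓧 → Fin K),
        Tendsto γ l atTop → Tendsto W l atTop →
        ((fun i => (W i : ℝ)) =o[l] fun i => Real.log (γ i)) →
        (∀ i, M.IsUCBPolicy v (W i) (A i)) →
        ∃ r : ι → ℝ, Tendsto r l (𝓝 0) ∧ ∀ᶠ i in l,
          M.worstCaseDelay 𝒜 (A i) (M.alarm (A i) (Real.log (γ i))) ≤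
            ENNReal.ofReal (Real.log (γ i) / M.maxKL 𝒜 h𝒜 * (1 + r i))) := by
  refine ⟨fun W A γ _ hA _ => M.ofReal_le_meanTimeToFalseAlarm hA.isControlPolicy γ, ?_⟩
  rintro 𝒜 h𝒜 ⟨a, ⟨ha, hKL⟩, huniq⟩ ι l γ W A hγ hW hWγ hA
  have hlog : Tendsto (fun i => Real.log (γ i)) l atTop := Real.tendsto_log_atTop.comp hγ
  -- Uniqueness of the maximiser provides the strict gap on which the logarithmic regret bound
  -- rests.
  have hmax : ∀ a' ∈ 𝒜, a' ≠ a → M.KL a' < M.KL a := fun a' ha' hne => by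
    have hle : M.KL a' ≤ M.maxKL 𝒜 h𝒜 := Finset.le_sup' M.KL ha'
    rw [hKL]
    exact lt_of_le_of_ne hle fun h => hne (huniq a' ⟨ha', h⟩)
  rw [← hKL]
  refine BanditQCD.exists_tendsto_zero_le_ofReal ?_ fun η hη =>
    hM.eventually_worstCaseDelay_le ha hmax hlog hW hWγ hA hη
  filter_upwards [hlog.eventually_gt_atTop 0] with i hi
  exact div_pos hi (hM.KL_pos a)
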